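/- Let $M\in\mathbb Z_+$ and, for $m=1,\dots,M$, let $b_m\in\mathbb R$, $r_m\ge 0$, $k_m>0$ with $k_m\notin\mathbb Z$, and let $\alpha_1,\dots,\alpha_M\in\mathbb R$ be pairwise distinct. Let $[x]$ denote the integer part of $x$, put $n_m=[k_m]$, and $$h(t)=\sum_{m=1}^M(-1)^{n_m+1}b_m\,(t+r_m)^{k_m}e^{-\alpha_m t},\qquad t>0 .$$ Let $C_0^\infty(\mathbb R_+)$ be the complex vector space of smooth complex-valued functions with compact support in $(0,\infty)$, and for $f\in C_0^\infty(\mathbb R_+)$ put $$h[f,f]=\int_0^\infty h(t)\,\overline{(\bar f\star f)(t)}\,dt,\qquad (\bar f\star f)(t)=\int_0^t\overline{f(s)}\,f(t-s)\,ds ,$$ which is a real number. Let $N_\pm(h)\in\{0,1,2,\dots\}\cup\{\infty\}$ be the maximal dimension of linear subspaces $\mathcal M\subset C_0^\infty(\mathbb R_+)$ such that $\pm h[f,f]>0$ for all $f\in\mathcal M$, $f\neq0$. Then: 1. If $b_m>0$ for some $m$, then $N_+(h)=\infty$. If $b_m<0$ for some $m$, then $N_-(h)=\infty$. 2. Put $\mathcal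 N=\sum_{m=1}^M[n_m/2]+M$. If $b_m<0$ for all $m$, then $N_+(h)=\mathcal N$. If $b_m>0$ for all $m$, then $N_-(h)=\mathcal N$. -/

import Mathlib

open scoped Distributions ComplexConjugate

noncomputable section

/-- The complex vector space `C₀^∞(ℝ₊)` of smooth complex-valued functions on the line whose
support is a compact subset of the open half-line `(0, ∞)`. -/
abbrev HalfLineTestFunction : Type :=
  𝓓((⟨Set.Ioi (0 : ℝ), isOpen_Ioi⟩ : TopologicalSpace.Opens ℝ), ℂ)

/-- The Laplace convolution `(f̄ ⋆ g)(t) = ∫₀ᵗ conj (f s) * g (t - s) ds`. -/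
def laplaceConv (f g : ℝ → ℂ) (t : ℝ) : ℂ :=
  ∫ s in (0 : ℝ)..t, conj (f s) * g (t - s)

/-- The pairing `⟨h, F⟩ = ∫₀^∞ h(t) conj (F t) dt`, linear in `h` and antilinear in `F`. -/
def halfLinePairing (h : ℝ → ℝ) (F : ℝ → ℂ) : ℂ :=
  ∫ t in Set.Ioi (0 : ℝ), (h t : ℂ) * conj (F t)

/-- The Hankel quadratic form `h[f, f] = ⟨h, f̄ ⋆ f⟩` of a real kernel `h` on `C₀^∞(ℝ₊)`, as a
real number; `halfLinePairing_laplaceConv_eq` shows that taking the real part loses nothing. -/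
def hankelForm (h : ℝ → ℝ) (f : HalfLineTestFunction) : ℝ :=
  (halfLinePairing h (laplaceConv f f)).re

theorem conj_laplaceConv_self (f : ℝ → ℂ) (t : ℝ) :
    conj (laplaceConv f f t) = laplaceConv f f t := by
  have h1 : conj (laplaceConv f f t) = ∫ s in (0 : ℝ)..t, f s * conj (f (t - s)) := by
    unfold laplaceConv
    rw [intervalIntegral.intervalIntegral_eq_integral_uIoc,
      intervalIntegral.intervalIntegral_eq_integral_uIoc, Complex.real_smul, Complex.real_smul,
      map_mul, Complex.conj_ofReal, ← integral_conj]
    simp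
  have h2 := intervalIntegral.integral_comp_sub_left (a := 0) (b := t)
    (fun s => conj (f s) * f (t - s)) t
  rw [h1]
  simp only [sub_sub_cancel, sub_self, sub_zero] at h2
  unfold laplaceConv
  rw [← h2]
  simp only [mul_comm]

/-- For a real kernel the quadratic form `⟨h, f̄ ⋆ f⟩` is real. -/
theorem halfLinePairing_laplaceConv_eq (h : ℝ → ℝ) (f : HalfLineTestFunction) :
    halfLinePairing h (laplaceConv f f) = (hankelForm h f : ℂ) := by
  symm
  apply Complex.conj_eq_iff_re.mp
  unfold halfLinePairing
  rw [← integral_conj]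
  simp only [map_mul, Complex.conj_ofReal, conj_laplaceConv_self]

/-- `N₊(q; V)`: the maximal dimension (as an element of `ℕ∞`) of the linear subspaces `W ⊆ V`
with `q φ > 0` for all nonzero `φ ∈ W`. It is `∞` if some such `W` is infinite-dimensional or if
the finite dimensions of such `W` are unbounded; for a Hermitian form `q` the two are equivalent,
because a maximal positive subspace of finite dimension splits off orthogonally and so bounds the
dimension of every positive subspace. -/
def positiveIndex {V : Type*} [AddCommGroup V] [Module ℂ V] (q : V → ℝ) : ℕ∞ :=
  ⨆ W : {W : Submodule ℂ V // ∀ φ ∈ W, φ ≠ 0 → 0 < q φ},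
    Cardinal.toENat (Module.rank ℂ W.1)

/-- `N₋(q; V)`: the maximal dimension of the linear subspaces `W ⊆ V` with `-q φ > 0` for all
nonzero `φ ∈ W`. -/
def negativeIndex {V : Type*} [AddCommGroup V] [Module ℂ V] (q : V → ℝ) : ℕ∞ :=
  positiveIndex fun φ => -q φ

/-- The kernel `h(t) = ∑ₘ (-1) ^ (nₘ + 1) bₘ (t + rₘ) ^ kₘ e ^ (-αₘ t)`, with `nₘ` the integer
part of `kₘ`. -/
def quasiCarlemanSum {M : ℕ} (b r k α : Fin M → ℝ) (t : ℝ) : ℝ :=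
  ∑ m, (-1 : ℝ) ^ (⌊k m⌋₊ + 1) * b m * (t + r m) ^ k m * Real.exp (-α m * t)

end

open scoped Distributions ComplexConjugate
open MeasureTheory Set Filter Topology Polynomial

/-! Write `n = [k]` and let `R` be the Taylor remainder of order `n + 1` of `exp (-x)`. Scaling the
integral of `x ^ (-k-1) * R x` represents `(-1) ^ (n+1) * y ^ k`, up to a positive constant, as the
integral of `x ^ (-k-1) * R (x * y)` over `x > 0`. Convergence at both ends is exactly `n < k < n +
1`, and the constant is positive because remainders of `exp (-x)` alternate in sign. Each term of
the kernel is thus, up to the sign of `b m`, a superposition of squares of Laplace transforms,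
corrected by polynomials of degree at most `n`.

Upper bound: in a term `s ^ a * t ^ c` of the correction, `a + c ≤ n`, so one exponent is at most `n
/ 2`. If all moments of `f` at `α m` up to order `[n m / 2]` vanish, every correction drops out and
the form has the sign of the `b m`. These are `∑ ([n m / 2] + 1)` linear conditions, and a subspace
of the opposite sign meets their kernel only in `0` (`re_integral_tensor_nonneg`,
`positiveIndex_le`).

Lower bounds: smeared point masses at `1, 2, 3, …` reduce the form to the matrices `h (a + c + 2)`,
that is, to the functional `X ^ a ↦ h (a + 2)` on products of polynomials; definiteness survives the
smearing (`card_le_positiveIndex`). On a polynomial `P` this functional is a sum over `m` of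
regularized integrals of `P (exp (-μ))` against densities singular at `μ = α m`, from which the
Taylor polynomial at the singularity is subtracted (`carlemanTerm_moment`).

If some `b m₀ > 0`, the total density is positive just to the right of `α m₀`, since its term blows
up there and the others stay bounded. Polynomials vanishing to high order at all nodes need no
regularization; concentrating them on that interval gives positive forms of every dimension
(`exists_posDef_of_pos`).

If all `b m < 0`, positivity must come from the subtracted terms. Polynomials with jet `x ^ i`, `i ≤
n m / 2`, at one node and zero jet at the others are multiplied by high powers of a cutoff that
touches `1` at that node. The integral proper dies out, and what remains is minus a definite
quadratic form in the jets, which a negative `b m` turns positive (`local_cutoff`,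
`exists_posDef_of_neg`). The number of jets equals the upper bound. -/

/-! ### Taylor remainders of the exponential. -/

/-- The remainder of order `n` of the power series of `exp (-x)`. -/
noncomputable def expTail (n : ℕ) (x : ℝ) : ℝ :=
  Real.exp (-x) - ∑ j ∈ Finset.range n, (-x) ^ j / (j.factorial : ℝ)

theorem expTail_succ (n : ℕ) (x : ℝ) :
    expTail (n + 1) x = expTail n x - (-x) ^ n / (n.factorial : ℝ) := by
  unfold expTail
  rw [Finset.sum_range_succ]
  ring

theorem hasDerivAt_expTail_succ (n : ℕ) (x : ℝ) :
    HasDerivAt (expTail (n + 1)) (-expTail n x) x := by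
  induction n with
  | zero =>
    have h : HasDerivAt (fun y : ℝ => Real.exp (-y) - 1) (Real.exp (-x) * (-1)) x :=
      ((hasDerivAt_neg x).exp).sub_const 1
    have e : expTail (0 + 1) = fun y : ℝ => Real.exp (-y) - 1 := by
      funext y
      simp [expTail]
    rw [e]
    simpa [expTail] using h
  | succ n ih =>
    have e : expTail (n + 1 + 1) = fun y : ℝ =>
        expTail (n + 1) y - (-y) ^ (n + 1) / ((n + 1).factorial : ℝ) := by
      funext y
      exact expTail_succ _ _
    rw [e, expTail_succ]
    have h2 : HasDerivAt (fun y : ℝ => (-y) ^ (n + 1) / ((n + 1).factorial : ℝ))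
        (-((-x) ^ n / (n.factorial : ℝ))) x := by
      refine (((hasDerivAt_neg x).fun_pow (n + 1)).div_const ((n + 1).factorial : ℝ)).congr_deriv ?_
      rw [Nat.factorial_succ]
      push_cast
      have : (n.factorial : ℝ) ≠ 0 := by positivity
      field_simp
    exact (ih.fun_sub h2).congr_deriv (by ring)

theorem continuous_expTail (n : ℕ) : Continuous (expTail n) := by
  unfold expTail
  fun_prop

theorem expTail_succ_zero (n : ℕ) : expTail (n + 1) 0 = 0 := by
  unfold expTail
  rw [Finset.sum_range_succ']
  simp

/-- Both `(-1) ^ (n+1) * expTail (n+1)` vanishes at `0` and its derivative is `(-1) ^ n * expTail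
n`, positive by induction. -/
theorem expTail_sign (n : ℕ) : ∀ x : ℝ, 0 < x → 0 < (-1 : ℝ) ^ n * expTail n x := by
  induction n with
  | zero =>
    intro x _
    simp [expTail, Real.exp_pos]
  | succ n ih =>
    intro x hx
    have hmono : StrictMonoOn (fun y => (-1 : ℝ) ^ (n + 1) * expTail (n + 1) y) (Ici 0) := by
      apply strictMonoOn_of_deriv_pos (convex_Ici 0)
      · exact ((continuous_expTail _).const_mul _).continuousOn
      · intro y hy
        rw [interior_Ici] at hy
        rw [((hasDerivAt_expTail_succ n y).const_mul _).deriv]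
        have := ih y hy
        rw [pow_succ]
        linarith
    have := hmono (mem_Ici.mpr le_rfl) (mem_Ici.mpr hx.le) hx
    simpa [expTail_succ_zero] using this

theorem abs_expTail_eq (n : ℕ) {x : ℝ} (hx : 0 < x) :
    |expTail n x| = (-1 : ℝ) ^ n * expTail n x := by
  rw [← abs_of_pos (expTail_sign n x hx), abs_mul, abs_pow]
  simp

/-- Consecutive remainders have opposite signs and differ by `(-x) ^ n / n!`, so this term dominates
both of them. The bound on `expTail n` serves near `0`, the one on `expTail (n + 1)` at infinity. -/
theorem abs_expTail_le (n : ℕ) {x : ℝ} (hx : 0 < x) : |expTail n x| ≤ x ^ n / n.factorial := by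
  have h1 := expTail_sign (n + 1) x hx
  rw [expTail_succ, neg_pow x n, pow_succ] at h1
  rw [abs_expTail_eq n hx]
  have h2 : (-1 : ℝ) ^ n * (-1) ^ n = 1 := by
    rw [← mul_pow]
    simp
  have : (-1 : ℝ) ^ n * -1 * (expTail n x - (-1) ^ n * x ^ n / n.factorial) =
      -((-1) ^ n * expTail n x) + ((-1 : ℝ) ^ n * (-1) ^ n) * (x ^ n / n.factorial) := by ring
  rw [this, h2] at h1
  linarith

theorem abs_expTail_succ_le (n : ℕ) {x : ℝ} (hx : 0 < x) :
    |expTail (n + 1) x| ≤ x ^ n / n.factorial := by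
  have h1 := expTail_sign n x hx
  rw [abs_expTail_eq _ hx, expTail_succ, neg_pow x n, pow_succ]
  have h2 : (-1 : ℝ) ^ n * (-1) ^ n = 1 := by
    rw [← mul_pow]
    simp
  have : (-1 : ℝ) ^ n * -1 * (expTail n x - (-1) ^ n * x ^ n / n.factorial) =
      -((-1) ^ n * expTail n x) + ((-1 : ℝ) ^ n * (-1) ^ n) * (x ^ n / n.factorial) := by ring
  rw [this, h2]
  linarith

/-! ### Non-integer powers as regularized Laplace integrals. -/

theorem integrableOn_Ioc_rpow {s : ℝ} (hs : -1 < s) :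
    IntegrableOn (fun x : ℝ => x ^ s) (Ioc 0 1) := by
  have := intervalIntegral.intervalIntegrable_rpow' (a := 0) (b := 1) hs
  rwa [intervalIntegrable_iff_integrableOn_Ioc_of_le zero_le_one] at this

theorem continuousOn_rpow_Ioi (s : ℝ) : ContinuousOn (fun x : ℝ => x ^ s) (Ioi 0) :=
  fun x hx => (Real.continuousAt_rpow_const x s (Or.inl (ne_of_gt hx))).continuousWithinAt

theorem integrableOn_Ioc_rpow_mul {k : ℝ} {n : ℕ} (hn : k < n + 1) {f : ℝ → ℝ}
    (hf : AEStronglyMeasurable f (volume.restrict (Ioc 0 1))) {C : ℝ}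
    (h : ∀ x ∈ Ioc (0 : ℝ) 1, |f x| ≤ C * x ^ (n + 1)) :
    IntegrableOn (fun x => x ^ (-k - 1) * f x) (Ioc 0 1) := by
  have hi : IntegrableOn (fun x : ℝ => C * x ^ ((n : ℝ) - k)) (Ioc 0 1) :=
    (integrableOn_Ioc_rpow (by linarith)).const_mul C
  refine Integrable.mono' hi ?_ ?_
  · exact (((continuousOn_rpow_Ioi _).mono Ioc_subset_Ioi_self).aestronglyMeasurable
      measurableSet_Ioc).mul hf
  · refine (ae_restrict_iff' measurableSet_Ioc).mpr (ae_of_all _ fun x hx => ?_)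
    have hx0 : 0 < x := hx.1
    rw [Real.norm_eq_abs, abs_mul, abs_of_pos (Real.rpow_pos_of_pos hx0 _)]
    calc x ^ (-k - 1) * |f x| ≤ x ^ (-k - 1) * (C * x ^ (n + 1)) :=
          mul_le_mul_of_nonneg_left (h x hx) (Real.rpow_pos_of_pos hx0 _).le
      _ = C * x ^ ((n : ℝ) - k) := by
          rw [mul_left_comm, ← Real.rpow_natCast, ← Real.rpow_add hx0]
          push_cast
          ring_nf

theorem integrableOn_Ioi_one_rpow_mul {k : ℝ} {n : ℕ} (hn : (n : ℝ) < k) {f : ℝ → ℝ}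
    (hf : AEStronglyMeasurable f (volume.restrict (Ioi 1))) {C : ℝ}
    (h : ∀ x ∈ Ioi (1 : ℝ), |f x| ≤ C * x ^ n) :
    IntegrableOn (fun x => x ^ (-k - 1) * f x) (Ioi 1) := by
  have hi : IntegrableOn (fun x : ℝ => C * x ^ ((n : ℝ) - k - 1)) (Ioi 1) :=
    (integrableOn_Ioi_rpow_of_lt (by linarith) zero_lt_one).const_mul C
  refine Integrable.mono' hi ?_ ?_
  · exact (((continuousOn_rpow_Ioi _).mono (Ioi_subset_Ioi zero_le_one)).aestronglyMeasurable
      measurableSet_Ioi).mul hf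
  · refine (ae_restrict_iff' measurableSet_Ioi).mpr (ae_of_all _ fun x hx => ?_)
    have hx0 : 0 < x := lt_trans zero_lt_one hx
    rw [Real.norm_eq_abs, abs_mul, abs_of_pos (Real.rpow_pos_of_pos hx0 _)]
    calc x ^ (-k - 1) * |f x| ≤ x ^ (-k - 1) * (C * x ^ n) :=
          mul_le_mul_of_nonneg_left (h x hx) (Real.rpow_pos_of_pos hx0 _).le
      _ = C * x ^ ((n : ℝ) - k - 1) := by
          rw [mul_left_comm, ← Real.rpow_natCast, ← Real.rpow_add hx0]
          ring_nf

/-- The exponents left over are `n - k > -1` at `0` and `n - k - 1 < -1` at infinity; this is where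
non-integrality of `k` enters. -/
theorem integrableOn_Ioi_rpow_mul {k : ℝ} {n : ℕ} (hn : (n : ℝ) < k) (hn' : k < n + 1)
    {f : ℝ → ℝ} (hf : AEStronglyMeasurable f (volume.restrict (Ioi 0))) {C C' : ℝ}
    (h : ∀ x ∈ Ioc (0 : ℝ) 1, |f x| ≤ C * x ^ (n + 1))
    (h' : ∀ x ∈ Ioi (1 : ℝ), |f x| ≤ C' * x ^ n) :
    IntegrableOn (fun x => x ^ (-k - 1) * f x) (Ioi 0) := by
  rw [← Ioc_union_Ioi_eq_Ioi zero_le_one]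
  exact (integrableOn_Ioc_rpow_mul hn'
    (hf.mono_measure (Measure.restrict_mono Ioc_subset_Ioi_self le_rfl)) h).union
    (integrableOn_Ioi_one_rpow_mul hn
    (hf.mono_measure (Measure.restrict_mono (Ioi_subset_Ioi zero_le_one) le_rfl)) h')

theorem integrableOn_rpow_mul_expTail {k : ℝ} {n : ℕ} (hn : (n : ℝ) < k) (hn' : k < n + 1) :
    IntegrableOn (fun x => x ^ (-k - 1) * expTail (n + 1) x) (Ioi 0) := by
  refine integrableOn_Ioi_rpow_mul hn hn' (continuous_expTail _).aestronglyMeasurable (C := 1)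
    (C' := 1) ?_ ?_
  · intro x hx
    have h1 : (1 : ℝ) ≤ (n + 1).factorial := by exact_mod_cast Nat.one_le_of_lt (Nat.factorial_pos _)
    have h2 : 0 < x ^ (n + 1) := pow_pos hx.1 _
    refine (abs_expTail_le _ hx.1).trans ?_
    rw [one_mul]
    exact div_le_self h2.le h1
  · intro x hx
    have hx0 : 0 < x := lt_trans zero_lt_one hx
    have h1 : (1 : ℝ) ≤ n.factorial := by exact_mod_cast Nat.one_le_of_lt (Nat.factorial_pos _)
    have h2 : 0 < x ^ n := pow_pos hx0 _
    refine (abs_expTail_succ_le _ hx0).trans ?_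
    rw [one_mul]
    exact div_le_self h2.le h1

/-- The normalizing constant `(-1) ^ (n + 1) Γ(-k)`, with `n` the integer part of `k`. -/
noncomputable def tailConst (k : ℝ) : ℝ :=
  ∫ x in Ioi (0 : ℝ), x ^ (-k - 1) * ((-1 : ℝ) ^ (⌊k⌋₊ + 1) * expTail (⌊k⌋₊ + 1) x)

theorem floor_lt_of_ne {k : ℝ} (hk : 0 < k) (hkZ : ∀ j : ℕ, k ≠ j) : (⌊k⌋₊ : ℝ) < k :=
  lt_of_le_of_ne (Nat.floor_le hk.le) (hkZ _).symm

theorem tailConst_pos {k : ℝ} (hk : 0 < k) (hkZ : ∀ j : ℕ, k ≠ j) : 0 < tailConst k := by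
  unfold tailConst
  have hpos : ∀ x ∈ Ioi (0 : ℝ),
      0 < x ^ (-k - 1) * ((-1 : ℝ) ^ (⌊k⌋₊ + 1) * expTail (⌊k⌋₊ + 1) x) := fun x hx =>
    mul_pos (Real.rpow_pos_of_pos hx _) (expTail_sign _ x hx)
  rw [setIntegral_pos_iff_support_of_nonneg_ae]
  · have : Ioi (0 : ℝ) ⊆ Function.support (fun x : ℝ =>
        x ^ (-k - 1) * ((-1 : ℝ) ^ (⌊k⌋₊ + 1) * expTail (⌊k⌋₊ + 1) x)) ∩ Ioi 0 :=
      fun x hx => ⟨(hpos x hx).ne', hx⟩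
    exact lt_of_lt_of_le (by simp) (measure_mono this)
  · exact (ae_restrict_iff' measurableSet_Ioi).mpr (ae_of_all _ fun x hx => (hpos x hx).le)
  · have := (integrableOn_rpow_mul_expTail (floor_lt_of_ne hk hkZ)
      (Nat.lt_floor_add_one k)).const_mul ((-1 : ℝ) ^ (⌊k⌋₊ + 1))
    refine this.congr (ae_of_all _ fun x => ?_)
    ring

theorem integrableOn_rpow_mul_expTail_mul {k : ℝ} (hk : 0 < k) (hkZ : ∀ j : ℕ, k ≠ j) {y : ℝ}
    (hy : 0 < y) :
    IntegrableOn (fun x => x ^ (-k - 1) * expTail (⌊k⌋₊ + 1) (x * y)) (Ioi 0) := by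
  have h := integrableOn_rpow_mul_expTail (floor_lt_of_ne hk hkZ) (Nat.lt_floor_add_one k)
  have h2 := (integrableOn_Ioi_comp_mul_right_iff
    (fun x => x ^ (-k - 1) * expTail (⌊k⌋₊ + 1) x) 0 hy).mpr (by simpa using h)
  have h3 := h2.const_mul (y ^ (k + 1))
  refine IntegrableOn.congr_fun h3 (fun x hx => ?_) measurableSet_Ioi
  have hx0 : (0 : ℝ) < x := hx
  rw [Real.mul_rpow hx0.le hy.le]
  have : y ^ (k + 1) * y ^ (-k - 1) = 1 := by
    rw [← Real.rpow_add hy]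
    simp
  linear_combination (x ^ (-k - 1) * expTail (⌊k⌋₊ + 1) (x * y)) * this

/-- The powers with non-integer exponents as regularized Laplace transforms. -/
theorem integral_rpow_mul_expTail {k : ℝ} {y : ℝ} (hy : 0 < y) :
    ∫ x in Ioi (0 : ℝ), x ^ (-k - 1) * expTail (⌊k⌋₊ + 1) (x * y) =
      tailConst k * ((-1 : ℝ) ^ (⌊k⌋₊ + 1) * y ^ k) := by
  have h := integral_comp_mul_right_Ioi
    (fun x => x ^ (-k - 1) * ((-1 : ℝ) ^ (⌊k⌋₊ + 1) * expTail (⌊k⌋₊ + 1) x)) 0 hy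
  rw [zero_mul] at h
  have h2 : ∫ x in Ioi (0 : ℝ), x ^ (-k - 1) * expTail (⌊k⌋₊ + 1) (x * y) =
      y ^ (k + 1) * (-1 : ℝ) ^ (⌊k⌋₊ + 1) * ∫ x in Ioi (0 : ℝ), (x * y) ^ (-k - 1) *
        ((-1 : ℝ) ^ (⌊k⌋₊ + 1) * expTail (⌊k⌋₊ + 1) (x * y)) := by
    rw [← integral_const_mul]
    refine setIntegral_congr_fun measurableSet_Ioi fun x hx => ?_
    have hx0 : (0 : ℝ) < x := hx
    rw [Real.mul_rpow hx0.le hy.le]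
    have h1 : y ^ (k + 1) * y ^ (-k - 1) = 1 := by
      rw [← Real.rpow_add hy]
      simp
    have h2 : (-1 : ℝ) ^ (⌊k⌋₊ + 1) * (-1) ^ (⌊k⌋₊ + 1) = 1 := by
      rw [← mul_pow]
      simp
    linear_combination -(x ^ (-k - 1) * expTail (⌊k⌋₊ + 1) (x * y)) * h1 *
      ((-1 : ℝ) ^ (⌊k⌋₊ + 1) * (-1) ^ (⌊k⌋₊ + 1)) -
      (x ^ (-k - 1) * expTail (⌊k⌋₊ + 1) (x * y)) * h2
  rw [h2, h, smul_eq_mul, tailConst, Real.rpow_add_one hy.ne']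
  field_simp

/-! ### The Hankel form as a double integral. -/

namespace HalfLineTestFunction

theorem eq_zero_of_nonpos (f : HalfLineTestFunction) {t : ℝ} (ht : t ≤ 0) : f t = 0 := by
  refine image_eq_zero_of_notMem_tsupport fun h => ?_
  have : (0 : ℝ) < t := f.tsupport_subset h
  exact absurd this (not_lt.mpr ht)

theorem pos_of_ne_zero (f : HalfLineTestFunction) {t : ℝ} (ht : f t ≠ 0) : 0 < t := by
  by_contra h
  exact ht (f.eq_zero_of_nonpos (not_lt.mp h))

theorem laplaceConv_eq (f : HalfLineTestFunction) {t : ℝ} (ht : 0 < t) :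
    laplaceConv f f t = ∫ s : ℝ, conj (f s) * f (t - s) := by
  unfold laplaceConv
  rw [intervalIntegral.integral_of_le ht.le]
  refine setIntegral_eq_integral_of_forall_compl_eq_zero fun s hs => ?_
  by_cases h0 : s ≤ 0
  · rw [f.eq_zero_of_nonpos h0]
    simp
  · have : t - s ≤ 0 := by
      by_contra h
      exact hs ⟨not_le.mp h0, by linarith⟩
    rw [f.eq_zero_of_nonpos this]
    simp

/-- Supports in `(0, ∞)` allow all integrals to run over the whole line; then Fubini and the
translation `t ↦ s + t` undo the convolution. -/
theorem halfLinePairing_eq (h : ℝ → ℝ) (hh : Continuous h) (f : HalfLineTestFunction) :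
    halfLinePairing h (laplaceConv f f) =
      ∫ s : ℝ, ∫ t : ℝ, (h (s + t) : ℂ) * (f s * conj (f t)) := by
  have h1 : halfLinePairing h (laplaceConv f f) =
      ∫ t : ℝ, ∫ s : ℝ, (h t : ℂ) * (f s * conj (f (t - s))) := by
    unfold halfLinePairing
    refine (setIntegral_congr_fun (g := fun t => ∫ s : ℝ, (h t : ℂ) * (f s * conj (f (t - s))))
      measurableSet_Ioi ?_).trans (setIntegral_eq_integral_of_forall_compl_eq_zero ?_)
    · intro t ht
      simp only
      rw [f.laplaceConv_eq ht, integral_const_mul, ← integral_conj]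
      simp
    · intro t ht
      rw [integral_const_mul]
      have : ∀ s : ℝ, f s * conj (f (t - s)) = 0 := fun s => by
        by_cases h0 : s ≤ 0
        · rw [f.eq_zero_of_nonpos h0, zero_mul]
        · have : t - s ≤ 0 := by
            have : t ≤ 0 := not_lt.mp ht
            linarith
          rw [f.eq_zero_of_nonpos this]
          simp
      simp [this]
  have hf := f.continuous
  rw [h1, integral_integral_swap_of_hasCompactSupport]
  · refine integral_congr_ae (ae_of_all _ fun s => ?_)
    simp only
    rw [← integral_add_left_eq_self _ s]
    simp
  · have : Continuous fun p : ℝ × ℝ => (h p.1 : ℂ) * (f p.2 * conj (f (p.1 - p.2))) := by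
      have h2 : Continuous fun z : ℂ => conj z := Complex.continuous_conj
      exact (Complex.continuous_ofReal.comp (hh.comp continuous_fst)).mul
        ((hf.comp continuous_snd).mul (h2.comp (hf.comp (continuous_fst.sub continuous_snd))))
    exact this
  · have hK : IsCompact ((fun p : ℝ × ℝ => (p.1 + p.2, p.1)) '' (tsupport f ×ˢ tsupport f)) :=
      (f.hasCompactSupport.isCompact.prod f.hasCompactSupport.isCompact).image (by fun_prop)
    refine HasCompactSupport.intro hK fun p hp => ?_
    have : p.2 ∉ tsupport f ∨ p.1 - p.2 ∉ tsupport f := by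
      by_contra! hc
      exact hp ⟨(p.2, p.1 - p.2), ⟨hc.1, hc.2⟩, by simp⟩
    rcases this with h | h
    · simp [Function.uncurry, image_eq_zero_of_notMem_tsupport h]
    · simp [Function.uncurry, image_eq_zero_of_notMem_tsupport h]

theorem continuous_tensor (f : HalfLineTestFunction) {g : ℝ × ℝ → ℂ} (hg : Continuous g) :
    Continuous fun p : ℝ × ℝ => g p * (f p.1 * conj (f p.2)) := by
  have hf := f.continuous
  have h2 : Continuous fun z : ℂ => conj z := Complex.continuous_conj
  exact hg.mul ((hf.comp continuous_fst).mul (h2.comp (hf.comp continuous_snd)))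

theorem integrable_tensor (f : HalfLineTestFunction) {g : ℝ × ℝ → ℂ} (hg : Continuous g) :
    Integrable fun p : ℝ × ℝ => g p * (f p.1 * conj (f p.2)) := by
  refine (f.continuous_tensor hg).integrable_of_hasCompactSupport ?_
  refine HasCompactSupport.intro
    (f.hasCompactSupport.isCompact.prod f.hasCompactSupport.isCompact) fun p hp => ?_
  have : p.1 ∉ tsupport f ∨ p.2 ∉ tsupport f := by
    by_contra! hc
    exact hp ⟨hc.1, hc.2⟩
  rcases this with h | h
  · simp [image_eq_zero_of_notMem_tsupport h]
  · simp [image_eq_zero_of_notMem_tsupport h]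

theorem integrable_mul (f : HalfLineTestFunction) {g : ℝ → ℂ} (hg : Continuous g) :
    Integrable fun t : ℝ => g t * f t :=
  (hg.mul f.continuous).integrable_of_hasCompactSupport f.hasCompactSupport.mul_left

theorem hankelForm_eq (h : ℝ → ℝ) (hh : Continuous h) (f : HalfLineTestFunction) :
    hankelForm h f = (∫ p : ℝ × ℝ, (h (p.1 + p.2) : ℂ) * (f p.1 * conj (f p.2))).re := by
  have hc : Continuous fun p : ℝ × ℝ => (h (p.1 + p.2) : ℂ) :=
    Complex.continuous_ofReal.comp (hh.comp (continuous_fst.add continuous_snd))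
  unfold hankelForm
  rw [f.halfLinePairing_eq h hh, Measure.volume_eq_prod, integral_prod]
  exact f.integrable_tensor hc

/-! ### Vanishing moments and the upper bound for the index. -/

/-- The derivatives of the Laplace transform of `f` at `α`, up to sign. -/
noncomputable def moment (f : HalfLineTestFunction) (α : ℝ) (j : ℕ) : ℂ :=
  ∫ t : ℝ, ((t : ℂ) ^ j * (Real.exp (-α * t) : ℂ)) * f t

theorem continuous_pow_mul_exp (α : ℝ) (j : ℕ) :
    Continuous fun t : ℝ => (t : ℂ) ^ j * (Real.exp (-α * t) : ℂ) := by
  fun_prop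

/-- Expanding the power produces products of moments of orders `a` and `c` with `a + c ≤ j ≤ n`, so
one of the two orders is at most `n / 2`. -/
theorem integral_tensor_pow (f : HalfLineTestFunction) (α r : ℝ) {n : ℕ}
    (hm : ∀ j ≤ n / 2, f.moment α j = 0) {j : ℕ} (hj : j ≤ n) :
    ∫ p : ℝ × ℝ, (((p.1 + p.2 + r) ^ j * Real.exp (-α * (p.1 + p.2)) : ℝ) : ℂ) *
      (f p.1 * conj (f p.2)) = 0 := by
  have h1 : ∀ p : ℝ × ℝ, (((p.1 + p.2 + r) ^ j * Real.exp (-α * (p.1 + p.2)) : ℝ) : ℂ) *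
      (f p.1 * conj (f p.2)) = ∑ a ∈ Finset.range (j + 1), ∑ c ∈ Finset.range (j - a + 1),
        (j.choose a * (j - a).choose c * (r : ℂ) ^ (j - a - c)) *
        (((((p.1 : ℂ) ^ a * (Real.exp (-α * p.1) : ℂ)) * f p.1)) *
        conj (((p.2 : ℂ) ^ c * (Real.exp (-α * p.2) : ℂ)) * f p.2)) := by
    intro p
    rw [add_assoc, mul_add, Real.exp_add, add_pow]
    generalize Real.exp (-α * p.1) = u
    generalize Real.exp (-α * p.2) = v
    push_cast
    rw [Finset.sum_mul, Finset.sum_mul]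
    refine Finset.sum_congr rfl fun a _ => ?_
    rw [add_pow]
    rw [Finset.mul_sum, Finset.sum_mul, Finset.sum_mul, Finset.sum_mul]
    refine Finset.sum_congr rfl fun c _ => ?_
    simp only [map_mul, map_pow, Complex.conj_ofReal]
    ring
  have hint : ∀ a c : ℕ, Integrable fun p : ℝ × ℝ =>
      ((((p.1 : ℂ) ^ a * (Real.exp (-α * p.1) : ℂ)) * f p.1)) *
        conj (((p.2 : ℂ) ^ c * (Real.exp (-α * p.2) : ℂ)) * f p.2) := by
    intro a c
    have hg : Continuous fun p : ℝ × ℝ => ((p.1 : ℂ) ^ a * (Real.exp (-α * p.1) : ℂ)) *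
        ((p.2 : ℂ) ^ c * (Real.exp (-α * p.2) : ℂ)) := by fun_prop
    refine (f.integrable_tensor hg).congr (ae_of_all _ fun p => ?_)
    simp only [map_mul, map_pow, Complex.conj_ofReal]
    ring
  simp_rw [h1]
  rw [integral_finsetSum]
  · refine Finset.sum_eq_zero fun a ha => ?_
    rw [integral_finsetSum]
    · refine Finset.sum_eq_zero fun c hc => ?_
      rw [integral_const_mul, Measure.volume_eq_prod,
        integral_prod_mul (fun s : ℝ => (((s : ℂ) ^ a * (Real.exp (-α * s) : ℂ)) * f s))
          (fun t : ℝ => conj (((t : ℂ) ^ c * (Real.exp (-α * t) : ℂ)) * f t)), integral_conj]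
      rw [Finset.mem_range] at ha hc
      have hac : a ≤ n / 2 ∨ c ≤ n / 2 := by omega
      rcases hac with h | h
      · have := hm a h
        unfold moment at this
        rw [this]
        simp
      · have := hm c h
        unfold moment at this
        rw [this]
        simp
    · exact fun c _ => (hint a c).const_mul _
  · exact fun a _ => integrable_finsetSum _ fun c _ => (hint a c).const_mul _

/-- The Taylor terms subtracted from the exponential integrate to zero by `integral_tensor_pow`; the
exponential itself factors in the two variables and leaves a squared modulus. -/
theorem integral_tensor_expTail (f : HalfLineTestFunction) (α r : ℝ) {n : ℕ}
    (hm : ∀ j ≤ n / 2, f.moment α j = 0) (x : ℝ) :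
    ∫ p : ℝ × ℝ, ((expTail (n + 1) (x * (p.1 + p.2 + r)) * Real.exp (-α * (p.1 + p.2)) : ℝ) : ℂ) *
      (f p.1 * conj (f p.2)) = ((Real.exp (-(x * r)) * Complex.normSq (f.moment (x + α) 0) : ℝ) : ℂ) := by
  have h1 : ∀ p : ℝ × ℝ,
      ((expTail (n + 1) (x * (p.1 + p.2 + r)) * Real.exp (-α * (p.1 + p.2)) : ℝ) : ℂ) *
      (f p.1 * conj (f p.2)) =
      (Real.exp (-(x * r)) : ℂ) * ((((p.1 : ℂ) ^ 0 * (Real.exp (-(x + α) * p.1) : ℂ)) * f p.1) *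
        conj (((p.2 : ℂ) ^ 0 * (Real.exp (-(x + α) * p.2) : ℂ)) * f p.2)) -
      ∑ j ∈ Finset.range (n + 1), (((-x) ^ j / (j.factorial : ℝ) : ℝ) : ℂ) *
        ((((p.1 + p.2 + r) ^ j * Real.exp (-α * (p.1 + p.2)) : ℝ) : ℂ) *
          (f p.1 * conj (f p.2))) := by
    intro p
    have he : Real.exp (-(x * (p.1 + p.2 + r))) * Real.exp (-α * (p.1 + p.2)) =
        Real.exp (-(x * r)) * (Real.exp (-(x + α) * p.1) * Real.exp (-(x + α) * p.2)) := by
      rw [← Real.exp_add, ← Real.exp_add, ← Real.exp_add]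
      ring_nf
    have he' := congrArg (fun y : ℝ => (y : ℂ)) he
    simp only [Complex.ofReal_mul] at he'
    unfold expTail
    simp only [map_mul, Complex.conj_ofReal, pow_zero, one_mul]
    rw [sub_mul, Complex.ofReal_sub, Complex.ofReal_mul, he', sub_mul, Finset.sum_mul,
      Complex.ofReal_sum, Finset.sum_mul]
    congr 1
    · ring
    · refine Finset.sum_congr rfl fun j _ => ?_
      rw [show -(x * (p.1 + p.2 + r)) = -x * (p.1 + p.2 + r) by ring, mul_pow]
      push_cast
      ring
  simp_rw [h1]
  have hg : ∀ j : ℕ, Continuous fun p : ℝ × ℝ =>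
      (((p.1 + p.2 + r) ^ j * Real.exp (-α * (p.1 + p.2)) : ℝ) : ℂ) := by
    intro j
    fun_prop
  rw [integral_sub, integral_finsetSum]
  · rw [integral_const_mul, Measure.volume_eq_prod,
        integral_prod_mul (fun s : ℝ => (((s : ℂ) ^ 0 * (Real.exp (-(x + α) * s) : ℂ)) * f s))
          (fun t : ℝ => conj (((t : ℂ) ^ 0 * (Real.exp (-(x + α) * t) : ℂ)) * f t)), integral_conj,
        ← Measure.volume_eq_prod]
    rw [Finset.sum_eq_zero, sub_zero]
    · rw [Complex.ofReal_mul, Complex.normSq_eq_conj_mul_self, mul_comm (conj _)]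
      rfl
    · intro j hj
      rw [Finset.mem_range] at hj
      rw [integral_const_mul, f.integral_tensor_pow α r hm (by omega), mul_zero]
  · exact fun j _ => (f.integrable_tensor (hg j)).const_mul _
  · have hg' : Continuous fun p : ℝ × ℝ => ((p.1 : ℂ) ^ 0 * (Real.exp (-(x + α) * p.1) : ℂ)) *
        ((p.2 : ℂ) ^ 0 * (Real.exp (-(x + α) * p.2) : ℂ)) := by fun_prop
    refine Integrable.const_mul ?_ _
    refine (f.integrable_tensor hg').congr (ae_of_all _ fun p => ?_)
    simp only [map_mul, map_pow, Complex.conj_ofReal]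
    ring
  · exact integrable_finsetSum _ fun j _ => (f.integrable_tensor (hg j)).const_mul _

end HalfLineTestFunction

namespace HalfLineTestFunction

/-- Inserting the integral representation of the power and exchanging integrals turns the form into
a positive superposition of squared Laplace transforms. -/
theorem re_integral_tensor_nonneg (f : HalfLineTestFunction) {α r k : ℝ} (hr : 0 ≤ r) (hk : 0 < k)
    (hkZ : ∀ j : ℕ, k ≠ j) (hm : ∀ j ≤ ⌊k⌋₊ / 2, f.moment α j = 0) :
    0 ≤ (∫ p : ℝ × ℝ, (((-1) ^ (⌊k⌋₊ + 1) * (p.1 + p.2 + r) ^ k * Real.exp (-α * (p.1 + p.2)) : ℝ) : ℂ) *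
      (f p.1 * conj (f p.2))).re := by
  have hc := tailConst_pos hk hkZ
  set n := ⌊k⌋₊ with hn
  set Φ : ℝ × ℝ → ℂ := fun p => (Real.exp (-α * (p.1 + p.2)) : ℂ) * (f p.1 * conj (f p.2)) with hΦ
  -- The representation of `y ^ k` is available only for `y > 0`, which the support of `f`
  -- guarantees.
  have hΦ0 : ∀ p : ℝ × ℝ, Φ p ≠ 0 → 0 < p.1 + p.2 + r := by
    intro p hp
    have h1 : f p.1 ≠ 0 := fun h => hp (by simp [hΦ, h])
    have h2 : f p.2 ≠ 0 := fun h => hp (by simp [hΦ, h])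
    have := f.pos_of_ne_zero h1
    have := f.pos_of_ne_zero h2
    linarith
  have hΦc : Continuous Φ := f.continuous_tensor (by fun_prop)
  set G : ℝ × ℝ → ℝ → ℂ := fun p x =>
    ((x ^ (-k - 1) * expTail (n + 1) (x * (p.1 + p.2 + r)) : ℝ) : ℂ) * Φ p with hG
  have hrow : ∀ p, ∫ x in Ioi (0 : ℝ), G p x =
      ((tailConst k * ((-1) ^ (n + 1) * (p.1 + p.2 + r) ^ k) : ℝ) : ℂ) * Φ p := by
    intro p
    by_cases h0 : Φ p = 0
    · simp [hG, h0]
    · simp only [hG]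
      rw [integral_mul_const, integral_complex_ofReal, hn, integral_rpow_mul_expTail (hΦ0 p h0)]
  have hint : Integrable (Function.uncurry G)
      ((volume : Measure (ℝ × ℝ)).prod (volume.restrict (Ioi (0 : ℝ)))) := by
    rw [integrable_prod_iff]
    · refine ⟨ae_of_all _ fun p => ?_, ?_⟩
      · by_cases h0 : Φ p = 0
        · simp [hG, h0, Function.uncurry]
        · simp only [hG, Function.uncurry]
          exact ((integrableOn_rpow_mul_expTail_mul hk hkZ (hΦ0 p h0)).ofReal).mul_const _
      -- The remainder has constant sign, so the integral of the norm is given by the same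
      -- representation and absolute integrability follows.
      · have hnorm : ∀ p : ℝ × ℝ, ∫ x in Ioi (0 : ℝ), ‖Function.uncurry G (p, x)‖ =
            ‖((tailConst k * (p.1 + p.2 + r) ^ k : ℝ) : ℂ) * Φ p‖ := by
          intro p
          by_cases h0 : Φ p = 0
          · simp [hG, h0, Function.uncurry]
          · have hp := hΦ0 p h0
            have h2 : ∀ x ∈ Ioi (0 : ℝ), ‖Function.uncurry G (p, x)‖ =
                (-1 : ℝ) ^ (n + 1) * ‖Φ p‖ *
                  (x ^ (-k - 1) * expTail (n + 1) (x * (p.1 + p.2 + r))) := by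
              intro x hx
              have hx0 : (0 : ℝ) < x := hx
              simp only [hG, Function.uncurry, norm_mul, Complex.norm_real, Real.norm_eq_abs]
              rw [abs_of_pos (Real.rpow_pos_of_pos hx0 _),
                abs_expTail_eq _ (mul_pos hx0 hp)]
              ring
            rw [setIntegral_congr_fun measurableSet_Ioi h2, integral_const_mul,
              integral_rpow_mul_expTail hp, norm_mul (Complex.ofReal _) (Φ p), Complex.norm_real,
              Real.norm_eq_abs, abs_of_pos (mul_pos hc (Real.rpow_pos_of_pos hp _)), ← hn]
            have h3 : (-1 : ℝ) ^ (n + 1) * (-1) ^ (n + 1) = 1 := by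
              rw [← mul_pow]
              simp
            linear_combination (‖Φ p‖ * tailConst k * (p.1 + p.2 + r) ^ k) * h3
        simp_rw [hnorm]
        refine Integrable.norm ?_
        have hcont : Continuous fun p : ℝ × ℝ =>
            ((tailConst k * (p.1 + p.2 + r) ^ k : ℝ) : ℂ) * (Real.exp (-α * (p.1 + p.2)) : ℂ) := by
          have : Continuous fun p : ℝ × ℝ => (p.1 + p.2 + r) ^ k :=
            (Real.continuous_rpow_const hk.le).comp (by fun_prop)
          fun_prop
        refine (f.integrable_tensor hcont).congr (ae_of_all _ fun p => ?_)
        simp only [hΦ]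
        ring
    · refine AEStronglyMeasurable.mul ?_ ?_
      · refine (Complex.measurable_ofReal.comp ?_).aestronglyMeasurable
        refine Measurable.mul ?_ ?_
        · fun_prop
        · exact (continuous_expTail _).measurable.comp (by fun_prop)
      · exact (hΦc.comp continuous_fst).aestronglyMeasurable
  have hswap := integral_integral_swap hint
  simp_rw [hrow] at hswap
  have hcol : ∀ x ∈ Ioi (0 : ℝ), ∫ p : ℝ × ℝ, G p x =
      ((x ^ (-k - 1) * (Real.exp (-(x * r)) * Complex.normSq (f.moment (x + α) 0)) : ℝ) : ℂ) := by
    intro x _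
    rw [Complex.ofReal_mul, ← f.integral_tensor_expTail α r hm x, ← integral_const_mul]
    refine integral_congr_ae (ae_of_all _ fun p => ?_)
    simp only [hG, hΦ, Complex.ofReal_mul]
    ring
  rw [setIntegral_congr_fun measurableSet_Ioi hcol, integral_complex_ofReal] at hswap
  have hfin : (tailConst k : ℂ) * ∫ p : ℝ × ℝ,
      (((-1) ^ (n + 1) * (p.1 + p.2 + r) ^ k * Real.exp (-α * (p.1 + p.2)) : ℝ) : ℂ) *
      (f p.1 * conj (f p.2)) =
      ((∫ x in Ioi (0 : ℝ), x ^ (-k - 1) *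
        (Real.exp (-(x * r)) * Complex.normSq (f.moment (x + α) 0)) : ℝ) : ℂ) := by
    rw [← hswap, ← integral_const_mul]
    refine integral_congr_ae (ae_of_all _ fun p => ?_)
    simp only [hΦ, Complex.ofReal_mul]
    ring
  have hre := congrArg Complex.re hfin
  rw [Complex.re_ofReal_mul, Complex.ofReal_re] at hre
  have hnn : 0 ≤ ∫ x in Ioi (0 : ℝ), x ^ (-k - 1) *
        (Real.exp (-(x * r)) * Complex.normSq (f.moment (x + α) 0)) :=
    setIntegral_nonneg measurableSet_Ioi fun x hx =>
      mul_nonneg (Real.rpow_pos_of_pos hx _).le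
        (mul_nonneg (Real.exp_pos _).le (Complex.normSq_nonneg _))
  exact nonneg_of_mul_nonneg_right (hre ▸ hnn) hc

end HalfLineTestFunction

theorem continuous_quasiCarlemanSum {M : ℕ} (b r k α : Fin M → ℝ) (hk : ∀ m, 0 < k m) :
    Continuous (quasiCarlemanSum b r k α) := by
  unfold quasiCarlemanSum
  refine continuous_finsetSum _ fun m _ => ?_
  have : Continuous fun t : ℝ => (t + r m) ^ k m :=
    (Real.continuous_rpow_const (hk m).le).comp (by fun_prop)
  fun_prop

namespace HalfLineTestFunction

/-- All the moments at the points `α m` of orders at most half of the integer part of `k m`. -/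
noncomputable def momentMap {M : ℕ} (k α : Fin M → ℝ) :
    HalfLineTestFunction →ₗ[ℂ] ((Σ m, Fin (⌊k m⌋₊ / 2 + 1)) → ℂ) where
  toFun f i := f.moment (α i.1) i.2
  map_add' f g := by
    funext i
    simp only [moment, Pi.add_apply]
    rw [← integral_add (f.integrable_mul (continuous_pow_mul_exp _ _))
      (g.integrable_mul (continuous_pow_mul_exp _ _))]
    refine integral_congr_ae (ae_of_all _ fun t => ?_)
    simp [mul_add]
  map_smul' c f := by
    funext i
    simp only [moment, Pi.smul_apply, RingHom.id_apply, smul_eq_mul]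
    rw [← integral_const_mul]
    refine integral_congr_ae (ae_of_all _ fun t => ?_)
    simp
    ring

theorem hankelForm_nonpos {M : ℕ} (b r k α : Fin M → ℝ) (hr : ∀ m, 0 ≤ r m) (hk : ∀ m, 0 < k m)
    (hkZ : ∀ m, ∀ j : ℕ, k m ≠ j) (hb : ∀ m, b m < 0) (f : HalfLineTestFunction)
    (hf : momentMap k α f = 0) : hankelForm (quasiCarlemanSum b r k α) f ≤ 0 := by
  rw [f.hankelForm_eq _ (continuous_quasiCarlemanSum b r k α hk)]
  have h1 : ∀ p : ℝ × ℝ, (quasiCarlemanSum b r k α (p.1 + p.2) : ℂ) * (f p.1 * conj (f p.2)) =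
      ∑ m, (b m : ℂ) * ((((-1) ^ (⌊k m⌋₊ + 1) * (p.1 + p.2 + r m) ^ k m *
        Real.exp (-α m * (p.1 + p.2)) : ℝ) : ℂ) * (f p.1 * conj (f p.2))) := by
    intro p
    unfold quasiCarlemanSum
    rw [Complex.ofReal_sum, Finset.sum_mul]
    refine Finset.sum_congr rfl fun m _ => ?_
    rw [← mul_assoc (b m : ℂ), ← Complex.ofReal_mul]
    congr 2
    ring
  simp_rw [h1]
  rw [integral_finsetSum]
  · rw [Complex.re_sum]
    refine Finset.sum_nonpos fun m _ => ?_
    rw [integral_const_mul, Complex.re_ofReal_mul]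
    refine mul_nonpos_of_nonpos_of_nonneg (hb m).le ?_
    refine f.re_integral_tensor_nonneg (hr m) (hk m) (hkZ m) fun j hj => ?_
    exact congrFun hf ⟨m, ⟨j, by omega⟩⟩
  · intro m _
    refine Integrable.const_mul (f.integrable_tensor ?_) _
    have : Continuous fun p : ℝ × ℝ => (p.1 + p.2 + r m) ^ k m :=
      (Real.continuous_rpow_const (hk m).le).comp (by fun_prop)
    fun_prop

end HalfLineTestFunction

/-- A positive subspace meets the kernel of `L` only in `0`, so `L` embeds it in `ι → ℂ`. -/
theorem positiveIndex_le {V ι : Type*} [AddCommGroup V] [Module ℂ V] [Fintype ι] (q : V → ℝ)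
    (L : V →ₗ[ℂ] (ι → ℂ)) (h : ∀ φ, L φ = 0 → q φ ≤ 0) :
    positiveIndex q ≤ (Fintype.card ι : ℕ∞) := by
  refine iSup_le fun W => ?_
  have hinj : Function.Injective (L.domRestrict W.1) := by
    rw [← LinearMap.ker_eq_bot, LinearMap.ker_eq_bot']
    intro φ hφ
    by_contra hne
    have h1 := W.2 φ.1 φ.2 (fun h0 => hne (Subtype.ext h0))
    have h2 := h φ.1 hφ
    linarith
  have := LinearMap.lift_rank_le_of_injective _ hinj
  have h3 := Cardinal.toENat.monotone' this
  simpa using h3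

theorem positiveIndex_quasiCarlemanSum_le {M : ℕ} (b r k α : Fin M → ℝ) (hr : ∀ m, 0 ≤ r m)
    (hk : ∀ m, 0 < k m) (hkZ : ∀ m, ∀ j : ℕ, k m ≠ j) (hb : ∀ m, b m < 0) :
    positiveIndex (hankelForm (quasiCarlemanSum b r k α)) ≤
      (((∑ m, ⌊k m⌋₊ / 2) + M : ℕ) : ℕ∞) := by
  have := positiveIndex_le _ (HalfLineTestFunction.momentMap k α)
    (HalfLineTestFunction.hankelForm_nonpos b r k α hr hk hkZ hb)
  simpa [Finset.sum_add_distrib] using this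

/-! ### From the Hankel form to a functional on polynomials. -/

/-- Positive definiteness is stable under entrywise convergence. -/
theorem eventually_posDef_of_tendsto {ι β : Type*} [Fintype ι] {l : Filter β}
    {A : β → ι → ι → ℝ} {A₀ : ι → ι → ℝ} (h : ∀ i j, Tendsto (fun ν => A ν i j) l (𝓝 (A₀ i j)))
    (hA : ∀ x : ι → ℝ, x ≠ 0 → 0 < ∑ i, ∑ j, x i * x j * A₀ i j) :
    ∀ᶠ ν in l, ∀ x : ι → ℝ, x ≠ 0 → 0 < ∑ i, ∑ j, x i * x j * A ν i j := by
  -- Positivity on the compact unit sphere is an open condition on the matrix; homogeneity then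
  -- extends it to all nonzero vectors.
  have hev : ∀ᶠ B in 𝓝 A₀, ∀ x ∈ Metric.sphere (0 : ι → ℝ) 1,
      0 < ∑ i, ∑ j, x i * x j * B i j := by
    refine (isCompact_sphere _ _).eventually_forall_of_forall_eventually fun x hx => ?_
    have hx0 : x ≠ 0 := by
      rintro rfl
      simp at hx
    have hc : Continuous fun z : (ι → ι → ℝ) × (ι → ℝ) =>
        ∑ i, ∑ j, z.2 i * z.2 j * z.1 i j := by
      fun_prop
    exact hc.continuousAt.eventually (lt_mem_nhds (hA x hx0))
  have ht : Tendsto A l (𝓝 A₀) := tendsto_pi_nhds.mpr fun i => tendsto_pi_nhds.mpr fun j => h i j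
  filter_upwards [ht.eventually hev] with ν hν x hx
  have hn : 0 < ‖x‖ := norm_pos_iff.mpr hx
  have h1 := hν (‖x‖⁻¹ • x) (by simp [norm_smul, hn.ne'])
  have h2 : ∑ i, ∑ j, (‖x‖⁻¹ • x) i * (‖x‖⁻¹ • x) j * A ν i j =
      ‖x‖⁻¹ ^ 2 * ∑ i, ∑ j, x i * x j * A ν i j := by
    rw [Finset.mul_sum]
    refine Finset.sum_congr rfl fun i _ => ?_
    rw [Finset.mul_sum]
    refine Finset.sum_congr rfl fun j _ => ?_
    simp only [Pi.smul_apply, smul_eq_mul]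
    ring
  rw [h2] at h1
  exact pos_of_mul_pos_right h1 (by positivity)

/-- The linear functional on polynomials with moments `h 0, h 1, …`. -/
noncomputable def momentFunctional (h : ℝ → ℝ) : ℝ[X] →ₗ[ℝ] ℝ :=
  Polynomial.lsum fun a => h a • LinearMap.id

theorem momentFunctional_monomial (h : ℝ → ℝ) (a : ℕ) (c : ℝ) :
    momentFunctional h (monomial a c) = c * h a := by
  simp [momentFunctional, Polynomial.lsum_apply, mul_comm]

theorem momentFunctional_mul (h : ℝ → ℝ) {P Q : ℝ[X]} {d : ℕ} (hP : P.natDegree < d)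
    (hQ : Q.natDegree < d) : momentFunctional h (P * Q) =
      ∑ a ∈ Finset.range d, ∑ c ∈ Finset.range d, P.coeff a * Q.coeff c * h (a + c) := by
  conv_lhs => rw [P.as_sum_range' d hP, Q.as_sum_range' d hQ]
  rw [Finset.sum_mul_sum, map_sum]
  refine Finset.sum_congr rfl fun a _ => ?_
  rw [map_sum]
  refine Finset.sum_congr rfl fun c _ => ?_
  rw [monomial_mul_monomial, momentFunctional_monomial]
  push_cast
  rfl

/-- A bump around the point `a + 1` whose support shrinks as `ν` grows. -/
noncomputable def nodeBump (a ν : ℕ) : ContDiffBump ((a : ℝ) + 1) where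
  rIn := ((ν : ℝ) + 3)⁻¹
  rOut := ((ν : ℝ) + 2)⁻¹
  rIn_pos := by positivity
  rIn_lt_rOut := by
    apply inv_strictAnti₀
    · positivity
    · linarith

/-- The approximation of the point mass at `a + 1` by smooth functions. -/
noncomputable def nodeFun (a ν : ℕ) : HalfLineTestFunction where
  toFun t := ((nodeBump a ν).normed volume t : ℝ)
  contDiff' := Complex.ofRealCLM.contDiff.comp (nodeBump a ν).contDiff_normed
  hasCompactSupport' := (nodeBump a ν).hasCompactSupport_normed.comp_left Complex.ofReal_zero
  tsupport_subset' := by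
    refine (closure_mono (Function.support_comp_subset Complex.ofReal_zero _)).trans ?_
    rw [← tsupport, (nodeBump a ν).tsupport_normed_eq]
    intro t ht
    rw [Metric.mem_closedBall, Real.dist_eq] at ht
    -- The centre `a + 1` is at least `1`, so a radius below `1` keeps the support inside `(0, ∞)`.
    have h1 : ((ν : ℝ) + 2)⁻¹ < 1 := inv_lt_one_of_one_lt₀ (by
      have : (0 : ℝ) ≤ ν := ν.cast_nonneg
      linarith)
    have h2 := (abs_le.mp ht).1
    have h3 : (0 : ℝ) ≤ a := a.cast_nonneg
    have h4 : (nodeBump a ν).rOut = ((ν : ℝ) + 2)⁻¹ := rfl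
    change 0 < t
    linarith

theorem nodeFun_apply (a ν : ℕ) (t : ℝ) :
    nodeFun a ν t = ((nodeBump a ν).normed volume t : ℝ) := rfl

theorem integrable_kernel_mul (h : ℝ → ℝ) (hh : Continuous h) {φ ψ : ℝ → ℝ} (hφ : Continuous φ)
    (hψ : Continuous ψ) (hφ' : HasCompactSupport φ) (hψ' : HasCompactSupport ψ) :
    Integrable fun p : ℝ × ℝ => h (p.1 + p.2) * (φ p.1 * ψ p.2) := by
  have hc : Continuous fun p : ℝ × ℝ => h (p.1 + p.2) * (φ p.1 * ψ p.2) := by fun_prop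
  refine hc.integrable_of_hasCompactSupport ?_
  refine HasCompactSupport.intro (hφ'.isCompact.prod hψ'.isCompact) fun p hp => ?_
  have : p.1 ∉ tsupport φ ∨ p.2 ∉ tsupport ψ := by
    by_contra! hc
    exact hp ⟨hc.1, hc.2⟩
  rcases this with h | h
  · simp [image_eq_zero_of_notMem_tsupport h]
  · simp [image_eq_zero_of_notMem_tsupport h]

/-- The product of the bumps has mass one and shrinks to the point `(a + 1, c + 1)`, where the
continuous kernel takes the value `h (a + c + 2)`. -/
theorem tendsto_integral_nodeBump (h : ℝ → ℝ) (hh : Continuous h) (a c : ℕ) :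
    Tendsto (fun ν : ℕ => ∫ p : ℝ × ℝ, h (p.1 + p.2) *
      ((nodeBump a ν).normed volume p.1 * (nodeBump c ν).normed volume p.2)) atTop
      (𝓝 (h (a + c + 2))) := by
  rw [Metric.tendsto_nhds]
  intro ε hε
  obtain ⟨δ, hδ, hδh⟩ := Metric.continuousAt_iff.mp (hh.continuousAt (x := (a : ℝ) + c + 2))
    (ε / 2) (half_pos hε)
  have hlim : Tendsto (fun ν : ℕ => ((ν : ℝ) + 2)⁻¹) atTop (𝓝 0) :=
    tendsto_inv_atTop_zero.comp
      (tendsto_atTop_add_const_right _ _ tendsto_natCast_atTop_atTop)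
  filter_upwards [hlim.eventually (gt_mem_nhds (half_pos hδ))] with ν hν
  have hone : ∫ p : ℝ × ℝ, (nodeBump a ν).normed volume p.1 * (nodeBump c ν).normed volume p.2
      = 1 := by
    rw [Measure.volume_eq_prod, integral_prod_mul, ContDiffBump.integral_normed,
      ContDiffBump.integral_normed, one_mul]
  have hia := (nodeBump a ν).continuous_normed (μ := volume)
  have hic := (nodeBump c ν).continuous_normed (μ := volume)
  have hca := (nodeBump a ν).hasCompactSupport_normed (μ := volume)
  have hcc := (nodeBump c ν).hasCompactSupport_normed (μ := volume)
  have hint1 := integrable_kernel_mul h hh hia hic hca hcc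
  have hint2 : Integrable fun p : ℝ × ℝ =>
      (nodeBump a ν).normed volume p.1 * (nodeBump c ν).normed volume p.2 := by
    simpa using integrable_kernel_mul (fun _ => 1) continuous_const hia hic hca hcc
  have hdiff : (∫ p : ℝ × ℝ, h (p.1 + p.2) *
      ((nodeBump a ν).normed volume p.1 * (nodeBump c ν).normed volume p.2)) - h (a + c + 2) =
      ∫ p : ℝ × ℝ, (h (p.1 + p.2) - h (a + c + 2)) *
        ((nodeBump a ν).normed volume p.1 * (nodeBump c ν).normed volume p.2) := by
    have hconst : ∫ p : ℝ × ℝ, h (a + c + 2) *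
        ((nodeBump a ν).normed volume p.1 * (nodeBump c ν).normed volume p.2) = h (a + c + 2) := by
      rw [integral_const_mul, hone, mul_one]
    conv_lhs => rw [← hconst]
    rw [← integral_sub hint1 (hint2.const_mul _)]
    simp only [sub_mul]
  rw [Real.dist_eq, hdiff]
  have hle : ‖∫ p : ℝ × ℝ, (h (p.1 + p.2) - h (a + c + 2)) *
        ((nodeBump a ν).normed volume p.1 * (nodeBump c ν).normed volume p.2)‖ ≤
      ∫ p : ℝ × ℝ, ε / 2 *
        ((nodeBump a ν).normed volume p.1 * (nodeBump c ν).normed volume p.2) := by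
    refine norm_integral_le_of_norm_le (hint2.const_mul _) (ae_of_all _ fun p => ?_)
    have hna := (nodeBump a ν).nonneg_normed (μ := volume) p.1
    have hnc := (nodeBump c ν).nonneg_normed (μ := volume) p.2
    rw [norm_mul, Real.norm_eq_abs, Real.norm_eq_abs, abs_of_nonneg (mul_nonneg hna hnc)]
    by_cases h0 : p.1 ∈ Metric.ball ((a : ℝ) + 1) (nodeBump a ν).rOut ∧
        p.2 ∈ Metric.ball ((c : ℝ) + 1) (nodeBump c ν).rOut
    · refine mul_le_mul_of_nonneg_right ?_ (mul_nonneg hna hnc)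
      have h1 : dist p.1 ((a : ℝ) + 1) < ((ν : ℝ) + 2)⁻¹ := h0.1
      have h2 : dist p.2 ((c : ℝ) + 1) < ((ν : ℝ) + 2)⁻¹ := h0.2
      have h3 : dist (p.1 + p.2) ((a : ℝ) + c + 2) < δ := by
        rw [Real.dist_eq] at *
        have : p.1 + p.2 - ((a : ℝ) + c + 2) = (p.1 - (a + 1)) + (p.2 - (c + 1)) := by ring
        rw [this]
        refine (abs_add_le _ _).trans_lt ?_
        linarith
      have := hδh h3
      rw [Real.dist_eq] at this
      exact this.le
    · have hz : (nodeBump a ν).normed volume p.1 * (nodeBump c ν).normed volume p.2 = 0 := by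
        rw [not_and_or] at h0
        rcases h0 with h0 | h0
        · rw [← (nodeBump a ν).support_normed_eq (μ := volume), Function.notMem_support] at h0
          rw [h0, zero_mul]
        · rw [← (nodeBump c ν).support_normed_eq (μ := volume), Function.notMem_support] at h0
          rw [h0, mul_zero]
      rw [hz]
      simp
  rw [integral_const_mul, hone] at hle
  rw [Real.norm_eq_abs] at hle
  linarith

/-- The matrix is real, and the real part of `x i * conj (x j)` splits, so complex coefficients
reduce to two real quadratic forms. -/
theorem hankelForm_sum_smul {ι : Type*} [Fintype ι] (h : ℝ → ℝ) (hh : Continuous h)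
    (ψ : ι → HalfLineTestFunction) (g : ι → ℝ → ℝ) (hg : ∀ i t, ψ i t = (g i t : ℂ)) (x : ι → ℂ) :
    hankelForm h (∑ i, x i • ψ i) =
      ∑ i, ∑ j, ((x i).re * (x j).re) * (∫ p : ℝ × ℝ, h (p.1 + p.2) * (g i p.1 * g j p.2)) +
      ∑ i, ∑ j, ((x i).im * (x j).im) * (∫ p : ℝ × ℝ, h (p.1 + p.2) * (g i p.1 * g j p.2)) := by
  have hgre : ∀ i t, g i t = (ψ i t).re := fun i t => by rw [hg]; simp
  have hgc : ∀ i, Continuous (g i) := fun i => by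
    have : g i = fun t => (ψ i t).re := funext (hgre i)
    rw [this]
    exact Complex.continuous_re.comp (ψ i).continuous
  have hgs : ∀ i, HasCompactSupport (g i) := fun i => by
    have : g i = Complex.re ∘ (ψ i) := funext (hgre i)
    rw [this]
    exact (ψ i).hasCompactSupport.comp_left Complex.zero_re
  have happ : ∀ t, (∑ i, x i • ψ i : HalfLineTestFunction) t = ∑ i, x i * (g i t : ℂ) := by
    intro t
    simp [hg]
  rw [HalfLineTestFunction.hankelForm_eq h hh]
  have h1 : ∀ p : ℝ × ℝ, (h (p.1 + p.2) : ℂ) * ((∑ i, x i • ψ i : HalfLineTestFunction) p.1 *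
      conj ((∑ i, x i • ψ i : HalfLineTestFunction) p.2)) =
      ∑ i, ∑ j, (x i * conj (x j)) * ((h (p.1 + p.2) * (g i p.1 * g j p.2) : ℝ) : ℂ) := by
    intro p
    rw [happ, happ, map_sum, Finset.sum_mul_sum, Finset.mul_sum]
    refine Finset.sum_congr rfl fun i _ => ?_
    rw [Finset.mul_sum]
    refine Finset.sum_congr rfl fun j _ => ?_
    simp only [map_mul, Complex.conj_ofReal, Complex.ofReal_mul]
    ring
  have hint : ∀ i j, Integrable fun p : ℝ × ℝ =>
      (x i * conj (x j)) * ((h (p.1 + p.2) * (g i p.1 * g j p.2) : ℝ) : ℂ) := fun i j =>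
    ((integrable_kernel_mul h hh (hgc i) (hgc j) (hgs i) (hgs j)).ofReal).const_mul _
  simp_rw [h1]
  rw [integral_finsetSum _ fun i _ => integrable_finsetSum _ fun j _ => hint i j, Complex.re_sum,
    ← Finset.sum_add_distrib]
  refine Finset.sum_congr rfl fun i _ => ?_
  rw [integral_finsetSum _ fun j _ => hint i j, Complex.re_sum, ← Finset.sum_add_distrib]
  refine Finset.sum_congr rfl fun j _ => ?_
  rw [integral_const_mul, integral_complex_ofReal, mul_comm, Complex.re_ofReal_mul]
  simp only [Complex.mul_re, Complex.conj_re, Complex.conj_im]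
  ring

/-- A polynomial is read as a combination of point masses at `1, 2, …`, whence the shift by `2` in
the functional. Smearing perturbs the matrix little, so it stays definite for some `ν`; definiteness
also makes the smeared functions linearly independent. -/
theorem card_le_positiveIndex {ι : Type*} [Fintype ι] (h : ℝ → ℝ) (hh : Continuous h)
    (P : ι → ℝ[X]) (hP : ∀ x : ι → ℝ, x ≠ 0 →
      0 < ∑ i, ∑ j, x i * x j * momentFunctional (fun t => h (t + 2)) (P i * P j)) :
    (Fintype.card ι : ℕ∞) ≤ positiveIndex (hankelForm h) := by
  obtain ⟨d, hd⟩ : ∃ d, ∀ i, (P i).natDegree < d := by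
    refine ⟨(∑ i, (P i).natDegree) + 1, fun i => Nat.lt_succ_of_le ?_⟩
    exact Finset.single_le_sum (f := fun i => (P i).natDegree) (fun _ _ => Nat.zero_le _)
      (Finset.mem_univ i)
  set g : ℕ → ι → ℝ → ℝ := fun ν i t =>
    ∑ a ∈ Finset.range d, (P i).coeff a * (nodeBump a ν).normed volume t with hg
  have hlim : ∀ i j, Tendsto (fun ν => ∫ p : ℝ × ℝ, h (p.1 + p.2) * (g ν i p.1 * g ν j p.2)) atTop
      (𝓝 (momentFunctional (fun t => h (t + 2)) (P i * P j))) := by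
    intro i j
    rw [momentFunctional_mul _ (hd i) (hd j)]
    have h1 : ∀ ν, ∫ p : ℝ × ℝ, h (p.1 + p.2) * (g ν i p.1 * g ν j p.2) =
        ∑ a ∈ Finset.range d, ∑ c ∈ Finset.range d, (P i).coeff a * (P j).coeff c *
          ∫ p : ℝ × ℝ, h (p.1 + p.2) *
            ((nodeBump a ν).normed volume p.1 * (nodeBump c ν).normed volume p.2) := by
      intro ν
      have hint : ∀ a c, Integrable fun p : ℝ × ℝ => (P i).coeff a * (P j).coeff c *
          (h (p.1 + p.2) *
            ((nodeBump a ν).normed volume p.1 * (nodeBump c ν).normed volume p.2)) := fun a c =>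
        (integrable_kernel_mul h hh (nodeBump a ν).continuous_normed
          (nodeBump c ν).continuous_normed (nodeBump a ν).hasCompactSupport_normed
          (nodeBump c ν).hasCompactSupport_normed).const_mul _
      simp_rw [← integral_const_mul]
      simp_rw [← integral_finsetSum (Finset.range d) fun c _ => hint _ c]
      rw [← integral_finsetSum _ fun a _ => integrable_finsetSum _ fun c _ => hint a c]
      refine integral_congr_ae (ae_of_all _ fun p => ?_)
      simp only [hg]
      rw [Finset.sum_mul_sum, Finset.mul_sum]
      refine Finset.sum_congr rfl fun a _ => ?_
      rw [Finset.mul_sum]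
      refine Finset.sum_congr rfl fun c _ => ?_
      ring
    simp_rw [h1]
    exact tendsto_finsetSum _ fun a _ => tendsto_finsetSum _ fun c _ =>
      (tendsto_integral_nodeBump h hh a c).const_mul _
  obtain ⟨ν, hν⟩ := (eventually_posDef_of_tendsto hlim hP).exists
  set ψ : ι → HalfLineTestFunction := fun i =>
    ∑ a ∈ Finset.range d, ((P i).coeff a : ℂ) • nodeFun a ν with hψ
  have hψg : ∀ i t, ψ i t = (g ν i t : ℂ) := by
    intro i t
    simp [hψ, hg, nodeFun_apply]
  have hpos : ∀ x : ι → ℂ, x ≠ 0 → 0 < hankelForm h (∑ i, x i • ψ i) := by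
    intro x hx
    rw [hankelForm_sum_smul h hh ψ (g ν) hψg]
    have hz : ∀ y : ι → ℝ, 0 ≤ ∑ i, ∑ j, y i * y j *
        ∫ p : ℝ × ℝ, h (p.1 + p.2) * (g ν i p.1 * g ν j p.2) := by
      intro y
      by_cases hy : y = 0
      · simp [hy]
      · exact (hν y hy).le
    by_cases hre : (fun i => (x i).re) = 0
    · have him : (fun i => (x i).im) ≠ 0 := fun him =>
        hx (funext fun i => Complex.ext (congrFun hre i) (congrFun him i))
      exact add_pos_of_nonneg_of_pos (hz fun i => (x i).re) (hν _ him)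
    · exact add_pos_of_pos_of_nonneg (hν _ hre) (hz fun i => (x i).im)
  set L : (ι → ℂ) →ₗ[ℂ] HalfLineTestFunction := Fintype.linearCombination ℂ ψ with hL
  have hLapp : ∀ x, L x = ∑ i, x i • ψ i := fun x => Fintype.linearCombination_apply ℂ ψ x
  have hinj : Function.Injective L := by
    rw [← LinearMap.ker_eq_bot, LinearMap.ker_eq_bot']
    intro x hx
    by_contra hne
    have := hpos x hne
    rw [← hLapp, hx] at this
    have h0 : hankelForm h 0 = 0 := by
      rw [HalfLineTestFunction.hankelForm_eq h hh]
      simp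
    linarith
  have hW : ∀ φ ∈ LinearMap.range L, φ ≠ 0 → 0 < hankelForm h φ := by
    rintro _ ⟨x, rfl⟩ hne
    rw [hLapp]
    exact hpos x fun h0 => hne (by rw [h0, map_zero])
  refine le_trans ?_ (le_iSup (fun W : {W : Submodule ℂ HalfLineTestFunction //
    ∀ φ ∈ W, φ ≠ 0 → 0 < hankelForm h φ} => Cardinal.toENat (Module.rank ℂ W.1))
    ⟨LinearMap.range L, hW⟩)
  have hr := Cardinal.toENat.monotone' (LinearMap.lift_rank_le_of_injective L.rangeRestrict
    (L.injective_rangeRestrict_iff.mpr hinj))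
  simpa using hr

/-! ### The polynomial functional as a regularized integral. -/

/-- The constant coefficient is the limit at `0` and hence vanishes; dividing by `X` lowers both the
degree and the order. This is the uniqueness of Taylor polynomials. -/
theorem Polynomial.eq_zero_of_abs_eval_le (n : ℕ) : ∀ (p : ℝ[X]) (C : ℝ), p.natDegree ≤ n →
    (∀ x ∈ Ioc (0 : ℝ) 1, |p.eval x| ≤ C * x ^ (n + 1)) → p = 0 := by
  have hzero : ∀ (n : ℕ) (p : ℝ[X]) (C : ℝ),
      (∀ x ∈ Ioc (0 : ℝ) 1, |p.eval x| ≤ C * x ^ (n + 1)) → p.coeff 0 = 0 := by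
    intro n p C h
    have h1 : Tendsto (fun x : ℝ => |p.eval x|) (𝓝[>] 0) (𝓝 |p.eval 0|) :=
      ((p.continuous.abs).tendsto 0).mono_left nhdsWithin_le_nhds
    have h2 : Tendsto (fun x : ℝ => C * x ^ (n + 1)) (𝓝[>] 0) (𝓝 (C * 0 ^ (n + 1))) :=
      ((by fun_prop : Continuous fun x : ℝ => C * x ^ (n + 1)).tendsto 0).mono_left
        nhdsWithin_le_nhds
    have h3 := le_of_tendsto_of_tendsto h1 h2 (by
      filter_upwards [Ioc_mem_nhdsGT (zero_lt_one (α := ℝ))] with x hx using h x hx)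
    rw [zero_pow (Nat.succ_ne_zero n), mul_zero] at h3
    rw [coeff_zero_eq_eval_zero]
    exact abs_nonpos_iff.mp h3
  induction n with
  | zero =>
    intro p C hd h
    have h0 := hzero 0 p C h
    rw [eq_C_of_natDegree_le_zero hd, h0, C_0]
  | succ n ih =>
    intro p C hd h
    have h0 := hzero (n + 1) p C h
    have hp : p.divX * X = p := by
      conv_rhs => rw [← p.divX_mul_X_add, h0, C_0, add_zero]
    rw [← hp, ih p.divX C, zero_mul]
    · rw [natDegree_divX_eq_natDegree_tsub_one]
      omega
    · intro x hx
      have h1 := h x hx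
      rw [← hp, eval_mul, eval_X, abs_mul, abs_of_pos hx.1, pow_succ, ← mul_assoc] at h1
      exact le_of_mul_le_mul_right h1 hx.1

theorem momentFunctional_eq_sum (h : ℝ → ℝ) (P : ℝ[X]) :
    momentFunctional h P = ∑ a ∈ P.support, P.coeff a * h a := by
  simp [momentFunctional, Polynomial.lsum_apply, Polynomial.sum_def, mul_comm]

/-- One term of the kernel with unit coefficient. -/
noncomputable def carlemanTerm (k r α t : ℝ) : ℝ :=
  (-1) ^ (⌊k⌋₊ + 1) * (t + r) ^ k * Real.exp (-α * t)

/-- The values of a polynomial on the exponential, in the coordinate adapted to the singularity. -/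
noncomputable def localValue (r α : ℝ) (P : ℝ[X]) (x : ℝ) : ℝ :=
  Real.exp (-(x * r)) * P.eval (Real.exp (-(x + α)))

theorem continuous_localValue (r α : ℝ) (P : ℝ[X]) : Continuous (localValue r α P) := by
  unfold localValue
  fun_prop

theorem sum_expTail_eq (n : ℕ) (r α : ℝ) (P : ℝ[X]) (x : ℝ) :
    ∑ a ∈ P.support, P.coeff a * Real.exp (-α * a) * expTail (n + 1) (x * (a + r)) =
      localValue r α P x - (∑ a ∈ P.support, ∑ j ∈ Finset.range (n + 1),
        monomial j (P.coeff a * Real.exp (-α * a) * ((-((a : ℝ) + r)) ^ j / (j.factorial : ℝ)))).eval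
          x := by
  unfold localValue
  rw [eval_eq_sum, Polynomial.sum_def, eval_finsetSum, Finset.mul_sum, ← Finset.sum_sub_distrib]
  refine Finset.sum_congr rfl fun a _ => ?_
  rw [expTail, mul_sub, Finset.mul_sum, eval_finsetSum]
  congr 1
  · rw [← Real.exp_nat_mul]
    have : Real.exp (-(x * r)) * Real.exp ((a : ℝ) * -(x + α)) =
        Real.exp (-α * a) * Real.exp (-(x * (a + r))) := by
      rw [← Real.exp_add, ← Real.exp_add]
      ring_nf
    linear_combination -(P.coeff a) * this
  · refine Finset.sum_congr rfl fun j _ => ?_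
    rw [eval_monomial, ← mul_neg, mul_pow]
    ring

/-- The representation of the powers is applied at `y = a + r`, positive even for `a = 0` because `r
> 0`, and summed over the coefficients of `P`. The regularizing polynomial it produces has degree at
most `n`, so by uniqueness any `T` with the right contact order equals it; its coefficients never
need to be computed. -/
theorem carlemanTerm_moment {k r : ℝ} (hk : 0 < k) (hkZ : ∀ j : ℕ, k ≠ j) (hr : 0 < r) (α : ℝ)
    (P T : ℝ[X]) (hT : T.natDegree ≤ ⌊k⌋₊) {C : ℝ}
    (h : ∀ x ∈ Ioc (0 : ℝ) 1, |localValue r α P x - T.eval x| ≤ C * x ^ (⌊k⌋₊ + 1)) :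
    IntegrableOn (fun x => x ^ (-k - 1) * (localValue r α P x - T.eval x)) (Ioi 0) ∧
    tailConst k * momentFunctional (carlemanTerm k r α) P =
      ∫ x in Ioi (0 : ℝ), x ^ (-k - 1) * (localValue r α P x - T.eval x) := by
  set n := ⌊k⌋₊ with hn
  set S : ℝ[X] := ∑ a ∈ P.support, ∑ j ∈ Finset.range (n + 1),
        monomial j (P.coeff a * Real.exp (-α * a) * ((-((a : ℝ) + r)) ^ j / (j.factorial : ℝ)))
    with hS
  have hsum : ∀ x, ∑ a ∈ P.support, P.coeff a * Real.exp (-α * a) * expTail (n + 1) (x * (a + r)) =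
      localValue r α P x - S.eval x := fun x => sum_expTail_eq n r α P x
  have hSdeg : S.natDegree ≤ n := by
    refine natDegree_sum_le_of_forall_le _ _ fun a _ =>
      natDegree_sum_le_of_forall_le _ _ fun j hj => ?_
    refine (natDegree_monomial_le _).trans ?_
    rw [Finset.mem_range] at hj
    omega
  have har : ∀ a : ℕ, 0 < (a : ℝ) + r := fun a => by positivity
  have hTS : T = S := by
    rw [← sub_eq_zero]
    refine Polynomial.eq_zero_of_abs_eval_le n (T - S)
      (C + ∑ a ∈ P.support, |P.coeff a * Real.exp (-α * a)| * (a + r) ^ (n + 1))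
      ((natDegree_sub_le _ _).trans (max_le hT hSdeg)) fun x hx => ?_
    have h1 := h x hx
    have h2 : |localValue r α P x - S.eval x| ≤
        (∑ a ∈ P.support, |P.coeff a * Real.exp (-α * a)| * (a + r) ^ (n + 1)) * x ^ (n + 1) := by
      rw [← hsum, Finset.sum_mul]
      refine (Finset.abs_sum_le_sum_abs _ _).trans (Finset.sum_le_sum fun a _ => ?_)
      rw [abs_mul, mul_assoc]
      refine mul_le_mul_of_nonneg_left ?_ (abs_nonneg _)
      have hp := mul_pos hx.1 (har a)
      refine (abs_expTail_le (n + 1) hp).trans ?_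
      have hf : (1 : ℝ) ≤ (n + 1).factorial := by
        exact_mod_cast Nat.one_le_of_lt (Nat.factorial_pos _)
      rw [mul_comm, ← mul_pow, mul_comm] at *
      exact div_le_self (pow_pos hp _).le hf
    rw [eval_sub, add_mul]
    have : T.eval x - S.eval x = (localValue r α P x - S.eval x) - (localValue r α P x - T.eval x) := by
      ring
    rw [this]
    refine (abs_sub _ _).trans ?_
    linarith
  have hint : ∀ a ∈ P.support, IntegrableOn (fun x => (P.coeff a * Real.exp (-α * a)) *
      (x ^ (-k - 1) * expTail (n + 1) (x * (a + r)))) (Ioi 0) := fun a _ =>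
    (integrableOn_rpow_mul_expTail_mul hk hkZ (har a)).const_mul _
  have hcongr : ∀ x, x ^ (-k - 1) * (localValue r α P x - T.eval x) =
      ∑ a ∈ P.support, (P.coeff a * Real.exp (-α * a)) *
        (x ^ (-k - 1) * expTail (n + 1) (x * (a + r))) := by
    intro x
    rw [hTS, ← hsum, Finset.mul_sum]
    refine Finset.sum_congr rfl fun a _ => ?_
    ring
  simp_rw [hcongr]
  refine ⟨integrable_finsetSum _ hint, ?_⟩
  rw [integral_finsetSum _ hint, momentFunctional_eq_sum, Finset.mul_sum]
  refine Finset.sum_congr rfl fun a _ => ?_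
  rw [integral_const_mul, hn, integral_rpow_mul_expTail (har a), carlemanTerm]
  ring

theorem quasiCarlemanSum_eq_sum {M : ℕ} (b r k α : Fin M → ℝ) (t : ℝ) :
    quasiCarlemanSum b r k α t = ∑ m, b m * carlemanTerm (k m) (r m) (α m) t := by
  unfold quasiCarlemanSum carlemanTerm
  refine Finset.sum_congr rfl fun m _ => ?_
  ring

/-- The shift that comes from the nodes `a + 1` stays within the same class of kernels, preserves
the signs of the coefficients and makes every `r m` strictly positive. -/
theorem quasiCarlemanSum_add_two {M : ℕ} (b r k α : Fin M → ℝ) (t : ℝ) :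
    quasiCarlemanSum b r k α (t + 2) =
      quasiCarlemanSum (fun m => b m * Real.exp (-α m * 2)) (fun m => r m + 2) k α t := by
  unfold quasiCarlemanSum
  refine Finset.sum_congr rfl fun m _ => ?_
  rw [mul_add, Real.exp_add, show t + 2 + r m = t + (r m + 2) by ring]
  ring

theorem momentFunctional_quasiCarlemanSum {M : ℕ} (b r k α : Fin M → ℝ) (hr : ∀ m, 0 < r m)
    (hk : ∀ m, 0 < k m) (hkZ : ∀ m, ∀ j : ℕ, k m ≠ j) (P : ℝ[X]) (T : Fin M → ℝ[X])
    (hT : ∀ m, (T m).natDegree ≤ ⌊k m⌋₊) {C : Fin M → ℝ}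
    (h : ∀ m, ∀ x ∈ Ioc (0 : ℝ) 1,
      |localValue (r m) (α m) P x - (T m).eval x| ≤ C m * x ^ (⌊k m⌋₊ + 1)) :
    momentFunctional (quasiCarlemanSum b r k α) P = ∑ m, b m / tailConst (k m) *
      ∫ x in Ioi (0 : ℝ), x ^ (-k m - 1) * (localValue (r m) (α m) P x - (T m).eval x) := by
  have h1 : momentFunctional (quasiCarlemanSum b r k α) P =
      ∑ m, b m * momentFunctional (carlemanTerm (k m) (r m) (α m)) P := by
    simp_rw [momentFunctional_eq_sum, quasiCarlemanSum_eq_sum, Finset.mul_sum]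
    rw [Finset.sum_comm]
    refine Finset.sum_congr rfl fun m _ => Finset.sum_congr rfl fun a _ => ?_
    ring
  rw [h1]
  refine Finset.sum_congr rfl fun m _ => ?_
  rw [← (carlemanTerm_moment (hk m) (hkZ m) (hr m) (α m) P (T m) (hT m) (h m)).2]
  have := (tailConst_pos (hk m) (hkZ m)).ne'
  field_simp

/-! ### Polynomials in the exponential near a node. -/

theorem exp_neg_add_mem_Icc {α Z x : ℝ} (hZ : Real.exp (-α) ≤ Z) (hx : 0 < x) :
    Real.exp (-(x + α)) ∈ Icc 0 Z :=
  ⟨(Real.exp_pos _).le, (Real.exp_le_exp.mpr (by linarith)).trans hZ⟩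

theorem exists_bound_comp_exp {g : ℝ → ℝ} (hg : Continuous g) (α : ℝ) :
    ∃ C, 0 ≤ C ∧ ∀ x : ℝ, 0 < x → |g (Real.exp (-(x + α)))| ≤ C := by
  obtain ⟨C, hC⟩ := (isCompact_Icc (a := (0 : ℝ)) (b := Real.exp (-α))).exists_bound_of_continuousOn
    hg.continuousOn
  refine ⟨|C|, abs_nonneg _, fun x hx => ?_⟩
  exact (hC _ (exp_neg_add_mem_Icc le_rfl hx)).trans (le_abs_self C)

theorem abs_exp_neg_add_sub_le (α : ℝ) {x : ℝ} (hx : 0 < x) :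
    |Real.exp (-(x + α)) - Real.exp (-α)| ≤ Real.exp (-α) * x := by
  have h1 : Real.exp (-(x + α)) - Real.exp (-α) = -(Real.exp (-α) * (1 - Real.exp (-x))) := by
    rw [show -(x + α) = -x + -α by ring, Real.exp_add]
    ring
  have h2 : 1 - Real.exp (-x) ≤ x := by
    have := Real.add_one_le_exp (-x)
    linarith
  have h3 : 0 ≤ 1 - Real.exp (-x) := by
    have := Real.exp_le_one_iff.mpr (neg_nonpos.mpr hx.le)
    linarith
  rw [h1, abs_neg, abs_of_nonneg (mul_nonneg (Real.exp_pos _).le h3)]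
  exact mul_le_mul_of_nonneg_left h2 (Real.exp_pos _).le

/-- Each factor `z - exp (-α)` is `O(x)` at `z = exp (-(x + α))`, and the cofactor is bounded
because `z` stays in a compact interval. -/
theorem exists_bound_of_dvd {α : ℝ} {K : ℕ} {P : ℝ[X]} (h : (X - C (Real.exp (-α))) ^ K ∣ P) :
    ∃ B, 0 ≤ B ∧ ∀ x : ℝ, 0 < x → |P.eval (Real.exp (-(x + α)))| ≤ B * x ^ K := by
  obtain ⟨Q, rfl⟩ := h
  obtain ⟨B, hB0, hB⟩ := exists_bound_comp_exp Q.continuous α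
  refine ⟨Real.exp (-α) ^ K * B, by positivity, fun x hx => ?_⟩
  rw [eval_mul, abs_mul, eval_pow, abs_pow, eval_sub, eval_X, eval_C]
  calc |Real.exp (-(x + α)) - Real.exp (-α)| ^ K * |Q.eval (Real.exp (-(x + α)))|
      ≤ (Real.exp (-α) * x) ^ K * B :=
        mul_le_mul (pow_le_pow_left₀ (abs_nonneg _) (abs_exp_neg_add_sub_le α hx) K) (hB x hx)
          (abs_nonneg _) (by positivity)
    _ = Real.exp (-α) ^ K * B * x ^ K := by rw [mul_pow]; ring

theorem exp_neg_mul_le_one {r x : ℝ} (hr : 0 ≤ r) (hx : 0 < x) : Real.exp (-(x * r)) ≤ 1 :=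
  Real.exp_le_one_iff.mpr (neg_nonpos.mpr (mul_nonneg hx.le hr))

/-! ### Positive spectral density and the infinite index. -/

/-- The part of the spectral density that is singular at `α`. -/
noncomputable def carlemanDensity (k r α μ : ℝ) : ℝ :=
  if α < μ then (μ - α) ^ (-k - 1) * Real.exp (-((μ - α) * r)) else 0

/-- The substitution `μ = x + α` puts the terms with different `α` on one spectral axis, where their
densities can be added. -/
theorem integral_Ioi_eq_carlemanDensity (k r α : ℝ) (g : ℝ → ℝ) :
    ∫ x in Ioi (0 : ℝ), x ^ (-k - 1) * (Real.exp (-(x * r)) * g (Real.exp (-(x + α)))) =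
      ∫ μ : ℝ, carlemanDensity k r α μ * g (Real.exp (-μ)) := by
  rw [← integral_indicator measurableSet_Ioi,
    ← integral_add_right_eq_self (fun μ : ℝ => carlemanDensity k r α μ * g (Real.exp (-μ))) α]
  refine integral_congr_ae (ae_of_all _ fun x => ?_)
  by_cases hx : 0 < x
  · simp [carlemanDensity, hx, mul_assoc]
  · simp [carlemanDensity, hx]

theorem integrable_carlemanDensity {k r α : ℝ} {g : ℝ → ℝ}
    (h : IntegrableOn (fun x => x ^ (-k - 1) *
      (Real.exp (-(x * r)) * g (Real.exp (-(x + α))))) (Ioi 0)) :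
    Integrable fun μ : ℝ => carlemanDensity k r α μ * g (Real.exp (-μ)) := by
  rw [← integrable_indicator_iff measurableSet_Ioi] at h
  refine (h.comp_sub_right α).congr (ae_of_all _ fun μ => ?_)
  by_cases hx : α < μ
  · simp only [indicator, mem_Ioi, sub_pos, hx, if_true, carlemanDensity, sub_add_cancel, mul_assoc]
  · simp [carlemanDensity, hx]

theorem continuousAt_carlemanDensity (k r : ℝ) {α μ : ℝ} (h : α ≠ μ) :
    ContinuousAt (carlemanDensity k r α) μ := by
  rcases lt_or_gt_of_ne h with h | h
  · have : carlemanDensity k r α =ᶠ[𝓝 μ]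
        fun μ => (μ - α) ^ (-k - 1) * Real.exp (-((μ - α) * r)) := by
      filter_upwards [lt_mem_nhds h] with ν hν
      simp [carlemanDensity, hν]
    refine ContinuousAt.congr ?_ this.symm
    have h0 : μ - α ≠ 0 := by
      intro h0
      linarith
    have h1 : ContinuousAt (fun μ : ℝ => (μ - α) ^ (-k - 1)) μ :=
      ContinuousAt.rpow_const (by fun_prop) (Or.inl h0)
    exact h1.mul (by fun_prop)
  · have : carlemanDensity k r α =ᶠ[𝓝 μ] fun _ => 0 := by
      filter_upwards [gt_mem_nhds h] with ν hν
      simp [carlemanDensity, not_lt.mpr hν.le]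
    exact continuousAt_const.congr this.symm

theorem tendsto_carlemanDensity {k : ℝ} (hk : 0 < k) (r α : ℝ) :
    Tendsto (carlemanDensity k r α) (𝓝[>] α) atTop := by
  have h1 : Tendsto (fun μ : ℝ => μ - α) (𝓝[>] α) (𝓝[>] 0) := by
    refine tendsto_nhdsWithin_iff.mpr ⟨?_, ?_⟩
    · have : Tendsto (fun μ : ℝ => μ - α) (𝓝 α) (𝓝 (α - α)) :=
        (by fun_prop : Continuous fun μ : ℝ => μ - α).tendsto α
      rw [sub_self] at this
      exact this.mono_left nhdsWithin_le_nhds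
    · filter_upwards [self_mem_nhdsWithin] with μ hμ
      exact sub_pos.mpr (mem_Ioi.mp hμ)
  have h2 : Tendsto (fun x : ℝ => x ^ (-k - 1)) (𝓝[>] 0) atTop :=
    tendsto_rpow_neg_nhdsGT_zero (by linarith)
  have h3 : Tendsto (fun μ : ℝ => Real.exp (-((μ - α) * r))) (𝓝[>] α) (𝓝 1) := by
    have : Tendsto (fun μ : ℝ => Real.exp (-((μ - α) * r))) (𝓝 α)
        (𝓝 (Real.exp (-((α - α) * r)))) :=
      (by fun_prop : Continuous fun μ : ℝ => Real.exp (-((μ - α) * r))).tendsto α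
    simp only [sub_self, zero_mul, neg_zero, Real.exp_zero] at this
    exact this.mono_left nhdsWithin_le_nhds
  refine ((h2.comp h1).atTop_mul_pos zero_lt_one h3).congr' ?_
  filter_upwards [self_mem_nhdsWithin] with μ hμ
  have : α < μ := hμ
  simp [carlemanDensity, this]

/-- The term `m₀` tends to infinity at `α m₀` from the right, while the others are continuous there
because the `α m` are distinct. -/
theorem exists_Ioo_density_pos {M : ℕ} (c r k α : Fin M → ℝ) (hk : ∀ m, 0 < k m)
    (hα : Function.Injective α) {m₀ : Fin M} (hc : 0 < c m₀) :
    ∃ q, α m₀ < q ∧ ∀ μ ∈ Ioo (α m₀) q, 0 < ∑ m, c m * carlemanDensity (k m) (r m) (α m) μ := by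
  have h1 : Tendsto (fun μ => ∑ m, c m * carlemanDensity (k m) (r m) (α m) μ) (𝓝[>] (α m₀))
      atTop := by
    have h2 : ∀ μ, ∑ m, c m * carlemanDensity (k m) (r m) (α m) μ =
        c m₀ * carlemanDensity (k m₀) (r m₀) (α m₀) μ +
          ∑ m ∈ Finset.univ.erase m₀, c m * carlemanDensity (k m) (r m) (α m) μ := fun μ =>
      (Finset.add_sum_erase _ _ (Finset.mem_univ m₀)).symm
    simp_rw [h2]
    refine Tendsto.atTop_add ((tendsto_carlemanDensity (hk m₀) (r m₀) (α m₀)).const_mul_atTop hc)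
      (C := ∑ m ∈ Finset.univ.erase m₀, c m * carlemanDensity (k m) (r m) (α m) (α m₀)) ?_
    refine tendsto_finsetSum _ fun m hm => ?_
    have hne : α m ≠ α m₀ := fun h => (Finset.ne_of_mem_erase hm) (hα h)
    exact ((continuousAt_carlemanDensity (k m) (r m) hne).tendsto.mono_left
      nhdsWithin_le_nhds).const_mul _
  have h3 := h1.eventually_gt_atTop 0
  obtain ⟨q, hq, hsub⟩ := (mem_nhdsGT_iff_exists_Ioo_subset).mp h3
  exact ⟨q, hq, hsub⟩

/-- The polynomial vanishing to order `K` at all the points `exp (-α m)`. -/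
noncomputable def nodePoly {M : ℕ} (α : Fin M → ℝ) (K : ℕ) : ℝ[X] :=
  ∏ m, (X - C (Real.exp (-α m))) ^ K

theorem nodePoly_ne_zero {M : ℕ} (α : Fin M → ℝ) (K : ℕ) : nodePoly α K ≠ 0 :=
  Finset.prod_ne_zero_iff.mpr fun _ _ => pow_ne_zero _ (X_sub_C_ne_zero _)

theorem dvd_nodePoly {M : ℕ} (α : Fin M → ℝ) (K : ℕ) (m : Fin M) :
    (X - C (Real.exp (-α m))) ^ K ∣ nodePoly α K :=
  Finset.dvd_prod_of_mem (fun m => (X - C (Real.exp (-α m))) ^ K) (Finset.mem_univ m)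

theorem integrableOn_rpow_mul_comp_exp {k r α : ℝ} (hk : 0 < k) (hkZ : ∀ j : ℕ, k ≠ j) (hr : 0 ≤ r)
    {P : ℝ[X]} (hP : (X - C (Real.exp (-α))) ^ (⌊k⌋₊ + 1) ∣ P) {g : ℝ → ℝ} (hg : Continuous g) :
    IntegrableOn (fun x => x ^ (-k - 1) * (Real.exp (-(x * r)) *
      (P.eval (Real.exp (-(x + α))) * g (Real.exp (-(x + α)))))) (Ioi 0) := by
  obtain ⟨B, hB0, hB⟩ := exists_bound_of_dvd hP
  obtain ⟨B', hB'0, hB'⟩ := exists_bound_comp_exp P.continuous α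
  obtain ⟨G, hG0, hG⟩ := exists_bound_comp_exp hg α
  refine integrableOn_Ioi_rpow_mul (n := ⌊k⌋₊) (floor_lt_of_ne hk hkZ) (Nat.lt_floor_add_one k)
    (Continuous.aestronglyMeasurable (by fun_prop)) (C := B * G) (C' := B' * G) ?_ ?_
  · intro x hx
    rw [abs_mul, abs_mul, abs_of_pos (Real.exp_pos _)]
    calc Real.exp (-(x * r)) * (|P.eval (Real.exp (-(x + α)))| * |g (Real.exp (-(x + α)))|)
        ≤ 1 * (B * x ^ (⌊k⌋₊ + 1) * G) :=
          mul_le_mul (exp_neg_mul_le_one hr hx.1) (mul_le_mul (hB x hx.1) (hG x hx.1)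
            (abs_nonneg _) (mul_nonneg hB0 (pow_nonneg hx.1.le _))) (by positivity) zero_le_one
      _ = B * G * x ^ (⌊k⌋₊ + 1) := by ring
  · intro x hx
    have hx0 : 0 < x := lt_trans zero_lt_one hx
    have hx1 : 1 ≤ x ^ ⌊k⌋₊ := one_le_pow₀ (le_of_lt hx)
    rw [abs_mul, abs_mul, abs_of_pos (Real.exp_pos _)]
    calc Real.exp (-(x * r)) * (|P.eval (Real.exp (-(x + α)))| * |g (Real.exp (-(x + α)))|)
        ≤ 1 * (B' * G) :=
          mul_le_mul (exp_neg_mul_le_one hr hx0) (mul_le_mul (hB' x hx0) (hG x hx0)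
            (abs_nonneg _) hB'0) (by positivity) zero_le_one
      _ ≤ B' * G * x ^ ⌊k⌋₊ := by
          rw [one_mul]
          exact le_mul_of_one_le_right (by positivity) hx1

theorem le_sum_floor {M : ℕ} (k : Fin M → ℝ) (m : Fin M) :
    ⌊k m⌋₊ + 1 ≤ ∑ m, (⌊k m⌋₊ + 1) :=
  Finset.single_le_sum (f := fun m => ⌊k m⌋₊ + 1) (fun _ _ => Nat.zero_le _) (Finset.mem_univ m)

theorem exp_le_sum {M : ℕ} (α : Fin M → ℝ) (m : Fin M) :
    Real.exp (-α m) ≤ ∑ m, Real.exp (-α m) :=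
  Finset.single_le_sum (f := fun m => Real.exp (-α m)) (fun _ _ => (Real.exp_pos _).le)
    (Finset.mem_univ m)

/-- Vanishing to order `[k m] + 1` at each node makes all regularizing polynomials zero. -/
theorem momentFunctional_of_dvd {M : ℕ} (b r k α : Fin M → ℝ) (hr : ∀ m, 0 < r m)
    (hk : ∀ m, 0 < k m) (hkZ : ∀ m, ∀ j : ℕ, k m ≠ j) (P : ℝ[X])
    (hP : ∀ m, (X - C (Real.exp (-α m))) ^ (⌊k m⌋₊ + 1) ∣ P) :
    momentFunctional (quasiCarlemanSum b r k α) P = ∑ m, b m / tailConst (k m) *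
      ∫ x in Ioi (0 : ℝ), x ^ (-k m - 1) * localValue (r m) (α m) P x := by
  choose B hB0 hB using fun m => exists_bound_of_dvd (hP m)
  rw [momentFunctional_quasiCarlemanSum b r k α hr hk hkZ P (fun _ => 0) (fun _ => by simp)
    (C := B)]
  · simp
  · intro m x hx
    rw [eval_zero, sub_zero, localValue, abs_mul, abs_of_pos (Real.exp_pos _)]
    exact (mul_le_of_le_one_left (abs_nonneg _) (exp_neg_mul_le_one (hr m).le hx.1)).trans
      (hB m x hx.1)

/-- Dominated convergence: the `p ν` are uniformly bounded on the values of the exponential, and the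
zero of `w` absorbs the singularity at `x = 0`. -/
theorem tendsto_integral_approx {k r α : ℝ} (hk : 0 < k) (hkZ : ∀ j : ℕ, k ≠ j) (hr : 0 ≤ r)
    {Z : ℝ} (hZ : Real.exp (-α) ≤ Z) {w : ℝ[X]} (hw : (X - C (Real.exp (-α))) ^ (⌊k⌋₊ + 1) ∣ w)
    {β : ℝ → ℝ} (hβ : Continuous β) {p : ℕ → ℝ[X]}
    (hp : ∀ ν, ∀ z ∈ Icc 0 Z, |(p ν).eval z - β z| < 1 / ((ν : ℝ) + 1)) (i j : ℕ) :
    Tendsto (fun ν => ∫ x in Ioi (0 : ℝ), x ^ (-k - 1) *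
        localValue r α (w * p ν * X ^ i * (w * p ν * X ^ j)) x) atTop
      (𝓝 (∫ x in Ioi (0 : ℝ), x ^ (-k - 1) * (Real.exp (-(x * r)) *
        ((w.eval (Real.exp (-(x + α))) * β (Real.exp (-(x + α)))) ^ 2 *
          Real.exp (-(x + α)) ^ (i + j))))) := by
  obtain ⟨G, hG0, hG⟩ := exists_bound_comp_exp hβ α
  have hzmem : ∀ x : ℝ, 0 < x → Real.exp (-(x + α)) ∈ Icc 0 Z := fun x hx =>
    exp_neg_add_mem_Icc hZ hx
  have hpb : ∀ ν, ∀ x : ℝ, 0 < x → |(p ν).eval (Real.exp (-(x + α)))| ≤ G + 1 := by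
    intro ν x hx
    have h1 := hp ν _ (hzmem x hx)
    have h2 := hG x hx
    have h3 : 1 / ((ν : ℝ) + 1) ≤ 1 := by
      rw [div_le_one (by positivity)]
      linarith [(ν.cast_nonneg : (0 : ℝ) ≤ ν)]
    have h4 := abs_sub_abs_le_abs_sub ((p ν).eval (Real.exp (-(x + α))))
      (β (Real.exp (-(x + α))))
    linarith
  refine tendsto_integral_of_dominated_convergence (fun x => |x ^ (-k - 1) * (Real.exp (-(x * r)) *
      ((w * w).eval (Real.exp (-(x + α))) * ((G + 1) ^ 2 * Real.exp (-(x + α)) ^ (i + j))))|)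
    ?_ ?_ ?_ ?_
  · intro ν
    refine AEStronglyMeasurable.mul ?_ (continuous_localValue _ _ _).aestronglyMeasurable
    exact (continuousOn_rpow_Ioi _).aestronglyMeasurable measurableSet_Ioi
  · exact (integrableOn_rpow_mul_comp_exp hk hkZ hr (dvd_mul_of_dvd_left hw w)
      (g := fun z => (G + 1) ^ 2 * z ^ (i + j)) (by fun_prop)).abs
  · intro ν
    refine (ae_restrict_iff' measurableSet_Ioi).mpr (ae_of_all _ fun x hx => ?_)
    have hz := Real.exp_pos (-(x + α))
    have h1 := hpb ν x hx
    rw [Real.norm_eq_abs, localValue]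
    simp only [eval_mul, eval_pow, eval_X]
    generalize Real.exp (-(x + α)) = z at hz h1 ⊢
    have h2 : (p ν).eval z ^ 2 ≤ (G + 1) ^ 2 := sq_le_sq' (by linarith [(abs_le.mp h1).1])
      (abs_le.mp h1).2
    rw [show x ^ (-k - 1) * (Real.exp (-(x * r)) * (w.eval z * (p ν).eval z * z ^ i *
      (w.eval z * (p ν).eval z * z ^ j))) = x ^ (-k - 1) * (Real.exp (-(x * r)) *
      (w.eval z * w.eval z * z ^ (i + j))) * (p ν).eval z ^ 2 by ring,
      show x ^ (-k - 1) * (Real.exp (-(x * r)) *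
      (w.eval z * w.eval z * ((G + 1) ^ 2 * z ^ (i + j)))) = x ^ (-k - 1) * (Real.exp (-(x * r)) *
      (w.eval z * w.eval z * z ^ (i + j))) * (G + 1) ^ 2 by ring, abs_mul, abs_mul _ ((G + 1) ^ 2),
      abs_of_nonneg (sq_nonneg ((p ν).eval z)), abs_of_nonneg (sq_nonneg (G + 1))]
    exact mul_le_mul_of_nonneg_left h2 (abs_nonneg _)
  · refine (ae_restrict_iff' measurableSet_Ioi).mpr (ae_of_all _ fun x hx => ?_)
    have hlim : Tendsto (fun ν => (p ν).eval (Real.exp (-(x + α)))) atTop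
        (𝓝 (β (Real.exp (-(x + α))))) := by
      rw [tendsto_iff_dist_tendsto_zero]
      refine squeeze_zero (fun _ => dist_nonneg) (fun ν => ?_)
        tendsto_one_div_add_atTop_nhds_zero_nat
      rw [Real.dist_eq]
      exact (hp ν _ (hzmem x hx)).le
    have h1 := ((hlim.pow 2).const_mul (x ^ (-k - 1) * Real.exp (-(x * r)) *
      w.eval (Real.exp (-(x + α))) ^ 2 * Real.exp (-(x + α)) ^ (i + j)))
    refine (h1.congr fun ν => ?_).trans (le_of_eq ?_)
    · rw [localValue]
      simp only [eval_mul, eval_pow, eval_X]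
      ring
    · congr 1
      ring

theorem sum_sum_mul_sum_comm {ι κ : Type*} [Fintype ι] [Fintype κ] (c : κ → ℝ) (x : ι → ℝ)
    (I : κ → ι → ι → ℝ) : ∑ i, ∑ j, x i * x j * ∑ m, c m * I m i j =
      ∑ m, c m * ∑ i, ∑ j, x i * x j * I m i j := by
  simp_rw [Finset.mul_sum]
  rw [Finset.sum_comm' (t' := Finset.univ) (s' := fun _ => Finset.univ) (by simp)]
  rw [Finset.sum_comm (s := (Finset.univ : Finset κ))]
  rw [Finset.sum_comm]
  refine Finset.sum_congr rfl fun i _ => ?_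
  rw [Finset.sum_comm]
  refine Finset.sum_congr rfl fun m _ => Finset.sum_congr rfl fun j _ => ?_
  ring

theorem integral_density_pos {s : ℝ → ℝ} {a q : ℝ} (haq : a < q)
    (hs : ∀ μ ∈ Ioo a q, 0 < s μ) {w v : ℝ[X]} (hw : w ≠ 0) (hv : v ≠ 0) {β : ℝ → ℝ}
    (hβ : ∀ μ ∈ Ioo a q, 0 < β (Real.exp (-μ))) (hβ' : ∀ μ, μ ∉ Ioo a q → β (Real.exp (-μ)) = 0)
    (hint : Integrable fun μ : ℝ => s μ *
      ((w.eval (Real.exp (-μ)) * β (Real.exp (-μ))) ^ 2 * v.eval (Real.exp (-μ)) ^ 2)) :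
    0 < ∫ μ : ℝ, s μ *
      ((w.eval (Real.exp (-μ)) * β (Real.exp (-μ))) ^ 2 * v.eval (Real.exp (-μ)) ^ 2) := by
  rw [integral_pos_iff_support_of_nonneg _ hint]
  · have hfin : {μ : ℝ | (w * v).eval (Real.exp (-μ)) = 0}.Finite := by
      have hinj : Function.Injective fun μ : ℝ => Real.exp (-μ) := fun x y h =>
        neg_injective (Real.exp_injective h)
      have : {μ : ℝ | (w * v).eval (Real.exp (-μ)) = 0} =
          (fun μ : ℝ => Real.exp (-μ)) ⁻¹' {z | (w * v).IsRoot z} := rfl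
      rw [this]
      exact (finite_setOfPred_isRoot (mul_ne_zero hw hv)).preimage hinj.injOn
    have hsub : Ioo a q \ {μ : ℝ | (w * v).eval (Real.exp (-μ)) = 0} ⊆
        Function.support fun μ : ℝ => s μ *
          ((w.eval (Real.exp (-μ)) * β (Real.exp (-μ))) ^ 2 * v.eval (Real.exp (-μ)) ^ 2) := by
      rintro μ ⟨hμ, hne⟩
      rw [mem_ofPred_eq, eval_mul, mul_eq_zero, not_or] at hne
      exact mul_ne_zero (hs μ hμ).ne' (mul_ne_zero (pow_ne_zero _ (mul_ne_zero hne.1 (hβ μ hμ).ne'))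
        (pow_ne_zero _ hne.2))
    refine lt_of_lt_of_le ?_ (measure_mono hsub)
    rw [measure_sdiff_null (hfin.measure_zero _)]
    simp [haq]
  · intro μ
    by_cases hμ : μ ∈ Ioo a q
    · exact mul_nonneg (hs μ hμ).le (by positivity)
    · simp [hβ' μ hμ]

/-- The trial polynomials are `w * p ν * X ^ i`, where `w` kills every singularity and `p ν`
approximates a bump `β` carried by the interval of positive density. In the limit the form becomes
the integral of the density against `(w β v) ^ 2`, with `v` the polynomial of coefficients `x`. -/
theorem exists_posDef_of_pos {M : ℕ} (b r k α : Fin M → ℝ) (hr : ∀ m, 0 < r m)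
    (hk : ∀ m, 0 < k m) (hkZ : ∀ m, ∀ j : ℕ, k m ≠ j) (hα : Function.Injective α) {m₀ : Fin M}
    (hb : 0 < b m₀) (N : ℕ) :
    ∃ P : Fin N → ℝ[X], ∀ x : Fin N → ℝ, x ≠ 0 →
      0 < ∑ i, ∑ j, x i * x j * momentFunctional (quasiCarlemanSum b r k α) (P i * P j) := by
  set c : Fin M → ℝ := fun m => b m / tailConst (k m) with hc
  have hc₀ : 0 < c m₀ := div_pos hb (tailConst_pos (hk m₀) (hkZ m₀))
  obtain ⟨q, hq, hpos⟩ := exists_Ioo_density_pos c r k α hk hα hc₀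
  set w := nodePoly α (∑ m, (⌊k m⌋₊ + 1)) with hw
  have hwd : ∀ m, (X - C (Real.exp (-α m))) ^ (⌊k m⌋₊ + 1) ∣ w := fun m =>
    (pow_dvd_pow _ (le_sum_floor k m)).trans (dvd_nodePoly α _ m)
  -- In the variable `z = exp (-μ)` the interval `(α m₀, q)` becomes `(exp (-q), exp (-α m₀))`; this
  -- tent-like function is positive exactly there.
  set β : ℝ → ℝ := fun z => max 0 ((z - Real.exp (-q)) * (Real.exp (-α m₀) - z)) with hβ
  have hβc : Continuous β := by fun_prop
  have hβpos : ∀ μ ∈ Ioo (α m₀) q, 0 < β (Real.exp (-μ)) := by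
    intro μ hμ
    refine lt_max_of_lt_right (mul_pos ?_ ?_)
    · exact sub_pos.mpr (Real.exp_lt_exp.mpr (neg_lt_neg hμ.2))
    · exact sub_pos.mpr (Real.exp_lt_exp.mpr (neg_lt_neg hμ.1))
  have hβzero : ∀ μ, μ ∉ Ioo (α m₀) q → β (Real.exp (-μ)) = 0 := by
    intro μ hμ
    refine max_eq_left ?_
    by_cases h1 : α m₀ < μ
    · have h2 : q ≤ μ := not_lt.mp fun h => hμ ⟨h1, h⟩
      refine mul_nonpos_of_nonpos_of_nonneg ?_ ?_
      · exact sub_nonpos.mpr (Real.exp_le_exp.mpr (neg_le_neg h2))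
      · exact sub_nonneg.mpr (Real.exp_le_exp.mpr (neg_le_neg h1.le))
    · have h2 := not_lt.mp h1
      refine mul_nonpos_of_nonneg_of_nonpos ?_ ?_
      · exact sub_nonneg.mpr (Real.exp_le_exp.mpr (neg_le_neg (h2.trans hq.le)))
      · exact sub_nonpos.mpr (Real.exp_le_exp.mpr (neg_le_neg h2))
  -- Weierstrass approximation on one interval that contains `exp (-(x + α m))` for all `m` and all
  -- `x > 0`.
  have happ : ∀ ν : ℕ, ∃ p : ℝ[X], ∀ z ∈ Icc 0 (∑ m, Real.exp (-α m)),
      |p.eval z - β z| < 1 / ((ν : ℝ) + 1) := fun ν =>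
    exists_polynomial_near_of_continuousOn _ _ β hβc.continuousOn _ Nat.one_div_pos_of_nat
  choose p hp using happ
  have hint : ∀ m, ∀ v : ℝ[X], IntegrableOn (fun x => x ^ (-k m - 1) * (Real.exp (-(x * r m)) *
      ((w.eval (Real.exp (-(x + α m))) * β (Real.exp (-(x + α m)))) ^ 2 *
        v.eval (Real.exp (-(x + α m)))))) (Ioi 0) := by
    intro m v
    refine (integrableOn_rpow_mul_comp_exp (hk m) (hkZ m) (hr m).le
      (dvd_mul_of_dvd_left (hwd m) w) (g := fun z => β z ^ 2 * v.eval z)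
      ((hβc.pow 2).mul v.continuous)).congr (ae_of_all _ fun x => ?_)
    simp only [eval_mul]
    ring
  have hlim : ∀ i j : Fin N, Tendsto (fun ν => momentFunctional (quasiCarlemanSum b r k α)
      (w * p ν * X ^ (i : ℕ) * (w * p ν * X ^ (j : ℕ)))) atTop
      (𝓝 (∑ m, c m * ∫ x in Ioi (0 : ℝ), x ^ (-k m - 1) * (Real.exp (-(x * r m)) *
        ((w.eval (Real.exp (-(x + α m))) * β (Real.exp (-(x + α m)))) ^ 2 *
          Real.exp (-(x + α m)) ^ ((i : ℕ) + j))))) := by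
    intro i j
    have hP : ∀ ν m, (X - C (Real.exp (-α m))) ^ (⌊k m⌋₊ + 1) ∣
        w * p ν * X ^ (i : ℕ) * (w * p ν * X ^ (j : ℕ)) := fun ν m =>
      (hwd m).trans ⟨p ν * X ^ (i : ℕ) * (w * p ν * X ^ (j : ℕ)), by ring⟩
    simp_rw [fun ν => momentFunctional_of_dvd b r k α hr hk hkZ _ (hP ν)]
    exact tendsto_finsetSum _ fun m _ => (tendsto_integral_approx (hk m) (hkZ m) (hr m).le
      (exp_le_sum α m) (hwd m) hβc hp i j).const_mul _
  have hlimpos : ∀ x : Fin N → ℝ, x ≠ 0 → 0 < ∑ i, ∑ j, x i * x j *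
      ∑ m, c m * ∫ y in Ioi (0 : ℝ), y ^ (-k m - 1) * (Real.exp (-(y * r m)) *
        ((w.eval (Real.exp (-(y + α m))) * β (Real.exp (-(y + α m)))) ^ 2 *
          Real.exp (-(y + α m)) ^ ((i : ℕ) + (j : ℕ)))) := by
    intro x hx
    set v : ℝ[X] := ∑ i : Fin N, monomial (i : ℕ) (x i) with hv
    have hvne : v ≠ 0 := by
      obtain ⟨i, hi⟩ := Function.ne_iff.mp hx
      intro h0
      apply hi
      have : v.coeff i = x i := by
        simp [hv, coeff_monomial, Fin.val_inj]
      rw [← this, h0]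
      simp
    have hveval : ∀ z, v.eval z = ∑ i : Fin N, x i * z ^ (i : ℕ) := fun z => by
      simp [hv, eval_finsetSum]
    have h1 : ∀ m, ∑ i, ∑ j, x i * x j * ∫ y in Ioi (0 : ℝ), y ^ (-k m - 1) *
        (Real.exp (-(y * r m)) *
        ((w.eval (Real.exp (-(y + α m))) * β (Real.exp (-(y + α m)))) ^ 2 *
          Real.exp (-(y + α m)) ^ ((i : ℕ) + (j : ℕ)))) =
        ∫ y in Ioi (0 : ℝ), y ^ (-k m - 1) * (Real.exp (-(y * r m)) *
        ((w.eval (Real.exp (-(y + α m))) * β (Real.exp (-(y + α m)))) ^ 2 *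
          v.eval (Real.exp (-(y + α m))) ^ 2)) := by
      intro m
      have hi : ∀ i j : Fin N, IntegrableOn (fun y => x i * x j * (y ^ (-k m - 1) *
        (Real.exp (-(y * r m)) *
        ((w.eval (Real.exp (-(y + α m))) * β (Real.exp (-(y + α m)))) ^ 2 *
          Real.exp (-(y + α m)) ^ ((i : ℕ) + (j : ℕ)))))) (Ioi 0) := by
        intro i j
        have := hint m (X ^ ((i : ℕ) + (j : ℕ)))
        simp only [eval_pow, eval_X] at this
        exact Integrable.const_mul this _
      simp_rw [← integral_const_mul]
      simp_rw [fun i => (integral_finsetSum Finset.univ fun j _ => hi i j).symm]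
      rw [← integral_finsetSum _ fun i _ => integrable_finsetSum _ fun j _ => hi i j]
      refine integral_congr_ae (ae_of_all _ fun y => ?_)
      simp only
      rw [hveval, sq (∑ i : Fin N, x i * Real.exp (-(y + α m)) ^ (i : ℕ)), Finset.sum_mul_sum]
      simp_rw [Finset.mul_sum]
      refine Finset.sum_congr rfl fun i _ => Finset.sum_congr rfl fun j _ => ?_
      rw [pow_add]
      ring
    have hμint : ∀ m, Integrable fun μ : ℝ => c m * (carlemanDensity (k m) (r m) (α m) μ *
        ((w.eval (Real.exp (-μ)) * β (Real.exp (-μ))) ^ 2 * v.eval (Real.exp (-μ)) ^ 2)) := by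
      intro m
      have := hint m (v ^ 2)
      simp only [eval_pow] at this
      exact (integrable_carlemanDensity (g := fun z => (w.eval z * β z) ^ 2 * v.eval z ^ 2)
        this).const_mul _
    have h2 : ∑ i, ∑ j, x i * x j *
      ∑ m, c m * ∫ y in Ioi (0 : ℝ), y ^ (-k m - 1) * (Real.exp (-(y * r m)) *
        ((w.eval (Real.exp (-(y + α m))) * β (Real.exp (-(y + α m)))) ^ 2 *
          Real.exp (-(y + α m)) ^ ((i : ℕ) + (j : ℕ)))) =
        ∫ μ : ℝ, (∑ m, c m * carlemanDensity (k m) (r m) (α m) μ) *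
          ((w.eval (Real.exp (-μ)) * β (Real.exp (-μ))) ^ 2 * v.eval (Real.exp (-μ)) ^ 2) := by
      simp_rw [Finset.sum_mul, mul_assoc]
      rw [integral_finsetSum _ fun m _ => hμint m]
      simp_rw [integral_const_mul, ← fun m => integral_Ioi_eq_carlemanDensity (k m) (r m) (α m)
        (fun z => (w.eval z * β z) ^ 2 * v.eval z ^ 2), ← h1]
      simp only [← mul_assoc (x _) (x _)]
      exact sum_sum_mul_sum_comm c x _
    rw [h2]
    refine integral_density_pos hq hpos (nodePoly_ne_zero α _) hvne hβpos hβzero ?_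
    simp_rw [Finset.sum_mul, mul_assoc]
    exact integrable_finsetSum _ fun m _ => hμint m
  obtain ⟨ν, hν⟩ := (eventually_posDef_of_tendsto hlim hlimpos).exists
  exact ⟨_, hν⟩

/-! ### Regularized integrals under powers of a cutoff. -/

theorem tendsto_integral_pow_mul {s : Set ℝ} (hs : MeasurableSet s) {E g : ℝ → ℝ}
    (hE : IntegrableOn E s) (hg : Continuous g) (hg0 : ∀ x ∈ s, 0 ≤ g x) (hg1 : ∀ x ∈ s, g x ≤ 1)
    (hae : ∀ᵐ x ∂volume.restrict s, g x ≠ 1) :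
    Tendsto (fun N : ℕ => ∫ x in s, g x ^ N * E x) atTop (𝓝 0) := by
  have h0 : (0 : ℝ) = ∫ x in s, (0 : ℝ) := by simp
  rw [h0]
  refine tendsto_integral_of_dominated_convergence (fun x => |E x|) ?_ hE.abs ?_ ?_
  · exact fun N => ((hg.pow N).aestronglyMeasurable).mul hE.aestronglyMeasurable
  · intro N
    refine (ae_restrict_iff' hs).mpr (ae_of_all _ fun x hx => ?_)
    rw [norm_mul, Real.norm_eq_abs, Real.norm_eq_abs, abs_of_nonneg (pow_nonneg (hg0 x hx) N)]
    exact mul_le_of_le_one_left (abs_nonneg _) (pow_le_one₀ (hg0 x hx) (hg1 x hx))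
  · filter_upwards [hae, ae_restrict_mem hs] with x hx hxs
    have := (tendsto_pow_atTop_nhds_zero_of_lt_one (hg0 x hxs)
      (lt_of_le_of_ne (hg1 x hxs) hx)).mul_const (E x)
    simpa using this

theorem Polynomial.exists_abs_eval_le_mul_pow {T : ℝ[X]} {n : ℕ} (hT : T.natDegree ≤ n) :
    ∃ C, 0 ≤ C ∧ ∀ x ∈ Ioi (1 : ℝ), |T.eval x| ≤ C * x ^ n := by
  refine ⟨∑ j ∈ Finset.range (n + 1), |T.coeff j|, by positivity, fun x hx => ?_⟩
  have hx1 : (1 : ℝ) ≤ x := le_of_lt hx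
  rw [eval_eq_sum_range' (Nat.lt_succ_of_le hT), Finset.sum_mul]
  refine (Finset.abs_sum_le_sum_abs _ _).trans (Finset.sum_le_sum fun j hj => ?_)
  rw [abs_mul, abs_of_nonneg (pow_nonneg (zero_le_one.trans hx1) j)]
  refine mul_le_mul_of_nonneg_left (pow_le_pow_right₀ hx1 ?_) (abs_nonneg _)
  rw [Finset.mem_range] at hj
  omega

theorem exists_bound_localValue {r : ℝ} (hr : 0 ≤ r) (α : ℝ) (P : ℝ[X]) :
    ∃ B, 0 ≤ B ∧ ∀ x : ℝ, 0 < x → |localValue r α P x| ≤ B := by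
  obtain ⟨B, hB0, hB⟩ := exists_bound_comp_exp P.continuous α
  refine ⟨B, hB0, fun x hx => ?_⟩
  rw [localValue, abs_mul, abs_of_pos (Real.exp_pos _)]
  exact (mul_le_of_le_one_left (abs_nonneg _) (exp_neg_mul_le_one hr hx)).trans (hB x hx)

theorem localValue_mul (r α : ℝ) (P Q : ℝ[X]) (x : ℝ) :
    localValue r α (P * Q) x = Q.eval (Real.exp (-(x + α))) * localValue r α P x := by
  rw [localValue, localValue, eval_mul]
  ring

theorem integrableOn_Ioi_one_eval {k : ℝ} (hk : 0 < k) (hkZ : ∀ j : ℕ, k ≠ j) {T : ℝ[X]}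
    (hT : T.natDegree ≤ ⌊k⌋₊) : IntegrableOn (fun x => x ^ (-k - 1) * T.eval x) (Ioi 1) := by
  obtain ⟨B, -, hB⟩ := Polynomial.exists_abs_eval_le_mul_pow hT
  exact integrableOn_Ioi_one_rpow_mul (floor_lt_of_ne hk hkZ)
    T.continuous.aestronglyMeasurable hB

/-- Near `exp (-α)` the cutoff `g ^ N` does not change the Taylor polynomial, and elsewhere it
decays, so that only the regularizing terms survive in the limit. -/
theorem local_cutoff {k r : ℝ} (hk : 0 < k) (hkZ : ∀ j : ℕ, k ≠ j) (hr : 0 < r) (α : ℝ)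
    {G g T : ℝ[X]} (hT : T.natDegree ≤ ⌊k⌋₊) {B : ℝ}
    (hB : ∀ x ∈ Ioc (0 : ℝ) 1, |localValue r α G x - T.eval x| ≤ B * x ^ (⌊k⌋₊ + 1))
    (hTg : T = 0 ∨ (X - C (Real.exp (-α))) ^ (⌊k⌋₊ + 1) ∣ 1 - g)
    (hg0 : ∀ x : ℝ, 0 < x → 0 ≤ g.eval (Real.exp (-(x + α))))
    (hg1 : ∀ x : ℝ, 0 < x → g.eval (Real.exp (-(x + α))) ≤ 1)
    (hae : ∀ᵐ x : ℝ, 0 < x → g.eval (Real.exp (-(x + α))) ≠ 1) :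
    ∃ E : ℕ → ℝ, Tendsto E atTop (𝓝 (-∫ x in Ioi (1 : ℝ), x ^ (-k - 1) * T.eval x)) ∧
      ∀ N : ℕ, (∃ B' : ℝ, ∀ x ∈ Ioc (0 : ℝ) 1,
        |localValue r α (G * g ^ N) x - T.eval x| ≤ B' * x ^ (⌊k⌋₊ + 1)) ∧
      IntegrableOn (fun x => x ^ (-k - 1) *
        ((g.eval (Real.exp (-(x + α))) ^ N - 1) * T.eval x)) (Ioc 0 1) ∧
      ∫ x in Ioi (0 : ℝ), x ^ (-k - 1) * (localValue r α (G * g ^ N) x - T.eval x) =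
        E N + ∫ x in Ioc (0 : ℝ) 1, x ^ (-k - 1) *
          ((g.eval (Real.exp (-(x + α))) ^ N - 1) * T.eval x) := by
  have hgc : Continuous fun x : ℝ => g.eval (Real.exp (-(x + α))) := by fun_prop
  have hn := floor_lt_of_ne hk hkZ
  have hn' := Nat.lt_floor_add_one k
  have hI1 : IntegrableOn (fun x => x ^ (-k - 1) * (localValue r α G x - T.eval x)) (Ioc 0 1) :=
    integrableOn_Ioc_rpow_mul hn'
      ((continuous_localValue r α G).sub T.continuous).aestronglyMeasurable hB
  obtain ⟨D, hD0, hD⟩ := exists_bound_localValue hr.le α G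
  have hI2 : IntegrableOn (fun x => x ^ (-k - 1) * localValue r α G x) (Ioi 1) := by
    refine integrableOn_Ioi_one_rpow_mul (C := D) hn
      (continuous_localValue r α G).aestronglyMeasurable fun x hx => ?_
    exact (hD x (lt_trans zero_lt_one hx)).trans
      (le_mul_of_one_le_right hD0 (one_le_pow₀ (le_of_lt hx)))
  have hI3 := integrableOn_Ioi_one_eval hk hkZ hT
  -- `1 - g` divides `1 - g ^ N`, so the contact order with `1` at the node is the same for every
  -- power.
  have hcut : ∀ N : ℕ, ∃ B' : ℝ, ∀ x ∈ Ioc (0 : ℝ) 1,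
      |(g.eval (Real.exp (-(x + α))) ^ N - 1) * T.eval x| ≤ B' * x ^ (⌊k⌋₊ + 1) := by
    intro N
    rcases hTg with h0 | hd
    · exact ⟨0, fun x _ => by simp [h0]⟩
    · have hd' : (X - C (Real.exp (-α))) ^ (⌊k⌋₊ + 1) ∣ 1 - g ^ N := by
        have := sub_dvd_pow_sub_pow (1 : ℝ[X]) g N
        rw [one_pow] at this
        exact hd.trans this
      obtain ⟨B1, hB10, hB1⟩ := exists_bound_of_dvd hd'
      obtain ⟨B2, hB2⟩ := (isCompact_Icc (a := (0 : ℝ)) (b := 1)).exists_bound_of_continuousOn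
        T.continuous.continuousOn
      refine ⟨B1 * B2, fun x hx => ?_⟩
      have h1 := hB1 x hx.1
      have h2 := hB2 x (Ioc_subset_Icc_self hx)
      rw [eval_sub, eval_one, eval_pow, abs_sub_comm] at h1
      rw [abs_mul]
      calc _ ≤ B1 * x ^ (⌊k⌋₊ + 1) * B2 :=
            mul_le_mul h1 h2 (abs_nonneg _) (mul_nonneg hB10 (pow_nonneg hx.1.le _))
        _ = B1 * B2 * x ^ (⌊k⌋₊ + 1) := by ring
  have hdecomp : ∀ (N : ℕ) (x : ℝ), localValue r α (G * g ^ N) x - T.eval x =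
      g.eval (Real.exp (-(x + α))) ^ N * (localValue r α G x - T.eval x) +
        (g.eval (Real.exp (-(x + α))) ^ N - 1) * T.eval x := by
    intro N x
    rw [localValue_mul, eval_pow]
    ring
  -- `E N` gathers the pieces that converge: two integrals killed by `g ^ N`, and the tail of `T` on
  -- `(1, ∞)`. The remaining integral over `(0, 1]` need not stay bounded in `N`, so it is kept
  -- explicit; only its sign is used later.
  refine ⟨fun N => (∫ x in Ioc (0 : ℝ) 1, g.eval (Real.exp (-(x + α))) ^ N *
      (x ^ (-k - 1) * (localValue r α G x - T.eval x))) +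
      ((∫ x in Ioi (1 : ℝ), g.eval (Real.exp (-(x + α))) ^ N *
        (x ^ (-k - 1) * localValue r α G x)) - ∫ x in Ioi (1 : ℝ), x ^ (-k - 1) * T.eval x),
    ?_, fun N => ⟨?_, ?_, ?_⟩⟩
  · have l1 := tendsto_integral_pow_mul measurableSet_Ioc hI1 hgc (fun x hx => hg0 x hx.1)
      (fun x hx => hg1 x hx.1) (by
        filter_upwards [ae_restrict_of_ae hae, ae_restrict_mem measurableSet_Ioc] with x h hx
        exact h hx.1)
    have l2 := tendsto_integral_pow_mul measurableSet_Ioi hI2 hgc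
      (fun x hx => hg0 x (lt_trans zero_lt_one hx))
      (fun x hx => hg1 x (lt_trans zero_lt_one hx)) (by
        filter_upwards [ae_restrict_of_ae hae, ae_restrict_mem measurableSet_Ioi] with x h hx
        exact h (lt_trans zero_lt_one hx))
    have := l1.add (l2.sub_const (∫ x in Ioi (1 : ℝ), x ^ (-k - 1) * T.eval x))
    simpa using this
  · obtain ⟨B', hB'⟩ := hcut N
    refine ⟨B + B', fun x hx => ?_⟩
    rw [hdecomp, add_mul]
    refine (abs_add_le _ _).trans (add_le_add ?_ (hB' x hx))
    rw [abs_mul, abs_of_nonneg (pow_nonneg (hg0 x hx.1) N)]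
    exact (mul_le_of_le_one_left (abs_nonneg _)
      (pow_le_one₀ (hg0 x hx.1) (hg1 x hx.1))).trans (hB x hx)
  · obtain ⟨B', hB'⟩ := hcut N
    exact integrableOn_Ioc_rpow_mul hn' (Continuous.aestronglyMeasurable (by fun_prop)) hB'
  · obtain ⟨B', hB'⟩ := hcut N
    have hV : IntegrableOn (fun x => x ^ (-k - 1) *
        ((g.eval (Real.exp (-(x + α))) ^ N - 1) * T.eval x)) (Ioc 0 1) :=
      integrableOn_Ioc_rpow_mul hn' (Continuous.aestronglyMeasurable (by fun_prop)) hB'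
    have hbd : ∀ {s : Set ℝ}, MeasurableSet s → s ⊆ Ioi 0 → ∀ {f : ℝ → ℝ}, IntegrableOn f s →
        IntegrableOn (fun x => g.eval (Real.exp (-(x + α))) ^ N * f x) s := by
      intro s hs hs0 f hf
      refine Integrable.bdd_mul (c := 1) hf (hgc.pow N).aestronglyMeasurable ?_
      refine (ae_restrict_iff' hs).mpr (ae_of_all _ fun x hx => ?_)
      rw [Real.norm_eq_abs, abs_of_nonneg (pow_nonneg (hg0 x (hs0 hx)) N)]
      exact pow_le_one₀ (hg0 x (hs0 hx)) (hg1 x (hs0 hx))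
    have hU := hbd measurableSet_Ioc Ioc_subset_Ioi_self hI1
    have hW := hbd measurableSet_Ioi (Ioi_subset_Ioi zero_le_one) hI2
    have e1 : ∀ x, x ^ (-k - 1) * (localValue r α (G * g ^ N) x - T.eval x) =
        g.eval (Real.exp (-(x + α))) ^ N * (x ^ (-k - 1) * (localValue r α G x - T.eval x)) +
        x ^ (-k - 1) * ((g.eval (Real.exp (-(x + α))) ^ N - 1) * T.eval x) := by
      intro x
      rw [hdecomp]
      ring
    have e2 : ∀ x, x ^ (-k - 1) * (localValue r α (G * g ^ N) x - T.eval x) =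
        g.eval (Real.exp (-(x + α))) ^ N * (x ^ (-k - 1) * localValue r α G x) -
        x ^ (-k - 1) * T.eval x := by
      intro x
      rw [localValue_mul, eval_pow]
      ring
    have i1 : IntegrableOn (fun x => x ^ (-k - 1) * (localValue r α (G * g ^ N) x - T.eval x))
        (Ioc 0 1) := by
      simp_rw [e1]
      exact hU.add hV
    have i2 : IntegrableOn (fun x => x ^ (-k - 1) * (localValue r α (G * g ^ N) x - T.eval x))
        (Ioi 1) := by
      simp_rw [e2]
      exact hW.sub hI3
    rw [← Ioc_union_Ioi_eq_Ioi (zero_le_one (α := ℝ)),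
      setIntegral_union (Ioc_disjoint_Ioi le_rfl) measurableSet_Ioi i1 i2]
    have j1 : ∫ x in Ioc (0 : ℝ) 1, x ^ (-k - 1) * (localValue r α (G * g ^ N) x - T.eval x) =
        (∫ x in Ioc (0 : ℝ) 1, g.eval (Real.exp (-(x + α))) ^ N *
          (x ^ (-k - 1) * (localValue r α G x - T.eval x))) +
        ∫ x in Ioc (0 : ℝ) 1, x ^ (-k - 1) *
          ((g.eval (Real.exp (-(x + α))) ^ N - 1) * T.eval x) := by
      simp_rw [e1]
      exact integral_add hU hV
    have j2 : ∫ x in Ioi (1 : ℝ), x ^ (-k - 1) * (localValue r α (G * g ^ N) x - T.eval x) =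
        (∫ x in Ioi (1 : ℝ), g.eval (Real.exp (-(x + α))) ^ N *
          (x ^ (-k - 1) * localValue r α G x)) - ∫ x in Ioi (1 : ℝ), x ^ (-k - 1) * T.eval x := by
      simp_rw [e2]
      exact integral_sub hW hI3
    rw [j1, j2]
    ring

/-! ### Polynomials with prescribed jets and the finite index. -/

/-- In the coordinate `y = 1 - exp (-x)` the target `exp (x * r) * x ^ i` is smooth near `0`, since
`x = -log (1 - y)`. Its Taylor polynomial in `y` is a polynomial in `exp (-(x + α))`, and the error
is of the right order because `y ≤ x`. -/
theorem exists_polynomial_approx (r α : ℝ) (i K : ℕ) : ∃ (R : ℝ[X]) (B : ℝ),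
    ∀ x ∈ Ioc (0 : ℝ) 1,
      |R.eval (Real.exp (-(x + α))) - Real.exp (x * r) * x ^ i| ≤ B * x ^ (K + 1) := by
  set ψ : ℝ → ℝ := fun y => Real.exp (-Real.log (1 - y) * r) * (-Real.log (1 - y)) ^ i with hψ
  have hb : (0 : ℝ) ≤ 1 - Real.exp (-1) := by
    have := Real.exp_le_one_iff.mpr (by norm_num : (-1 : ℝ) ≤ 0)
    linarith
  have hsm : ContDiffOn ℝ (K + 1) ψ (Icc 0 (1 - Real.exp (-1))) := by
    have hlog : ContDiffOn ℝ (K + 1) (fun y : ℝ => Real.log (1 - y)) (Icc 0 (1 - Real.exp (-1))) := by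
      refine ContDiffOn.log (by fun_prop) fun y hy => ?_
      have := Real.exp_pos (-1)
      have := hy.2
      intro h0
      linarith
    exact ((hlog.neg.mul contDiffOn_const).exp).mul (hlog.neg.pow i)
  obtain ⟨B, hB⟩ := exists_taylor_mean_remainder_bound hb hsm
  set R₀ : ℝ[X] := ∑ j ∈ Finset.range (K + 1), C ((j.factorial : ℝ)⁻¹ *
    iteratedDerivWithin j ψ (Icc 0 (1 - Real.exp (-1))) 0) * X ^ j with hR₀
  have hR₀eval : ∀ y, R₀.eval y = taylorWithinEval ψ K (Icc 0 (1 - Real.exp (-1))) 0 y := by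
    intro y
    rw [taylor_within_apply, hR₀, eval_finsetSum]
    refine Finset.sum_congr rfl fun j _ => ?_
    simp
    ring
  refine ⟨R₀.comp (1 - C (Real.exp α) * X), B, fun x hx => ?_⟩
  have hy : (1 - C (Real.exp α) * X : ℝ[X]).eval (Real.exp (-(x + α))) = 1 - Real.exp (-x) := by
    simp only [eval_sub, eval_one, eval_mul, eval_C, eval_X]
    rw [← Real.exp_add]
    ring_nf
  have hmem : 1 - Real.exp (-x) ∈ Icc 0 (1 - Real.exp (-1)) := by
    refine ⟨sub_nonneg.mpr (Real.exp_le_one_iff.mpr (by linarith [hx.1])), ?_⟩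
    have := Real.exp_le_exp.mpr (neg_le_neg hx.2)
    linarith
  have hψx : ψ (1 - Real.exp (-x)) = Real.exp (x * r) * x ^ i := by
    simp [hψ]
  have h1 := hB _ hmem
  rw [eval_comp, hy, hR₀eval, ← hψx, abs_sub_comm]
  refine h1.trans ?_
  rw [sub_zero]
  -- The remainder estimate at the right endpoint, where the power is positive, forces the constant
  -- to be nonnegative.
  have hB0 : 0 ≤ B := by
    have h2 := hB _ (right_mem_Icc.mpr hb)
    have h3 := (norm_nonneg _).trans h2
    have h4 : (0 : ℝ) < 1 - Real.exp (-1) - 0 := by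
      have := Real.exp_lt_exp.mpr (by norm_num : (-1 : ℝ) < 0)
      rw [Real.exp_zero] at this
      linarith
    exact nonneg_of_mul_nonneg_left h3 (pow_pos h4 _)
  refine mul_le_mul_of_nonneg_left (pow_le_pow_left₀ hmem.1 ?_ _) hB0
  have := Real.add_one_le_exp (-x)
  linarith

/-- Chinese remainders: the `(K + 1)`-th powers at distinct nodes are coprime, so a polynomial with
the wanted jet at `α m` can be corrected to vanish at the other nodes without changing that jet. -/
theorem exists_localPoly {M : ℕ} (α : Fin M → ℝ) (hα : Function.Injective α) {r : ℝ} (hr : 0 ≤ r)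
    (m : Fin M) (i K : ℕ) : ∃ G : ℝ[X], (∀ l, l ≠ m → (X - C (Real.exp (-α l))) ^ (K + 1) ∣ G) ∧
      ∃ B : ℝ, ∀ x ∈ Ioc (0 : ℝ) 1, |localValue r (α m) G x - x ^ i| ≤ B * x ^ (K + 1) := by
  set w : ℝ[X] := ∏ l ∈ Finset.univ.erase m, (X - C (Real.exp (-α l))) ^ (K + 1) with hw
  have hcop : IsCoprime w ((X - C (Real.exp (-α m))) ^ (K + 1)) := by
    refine IsCoprime.prod_left fun l hl => IsCoprime.pow ?_
    refine isCoprime_X_sub_C_of_isUnit_sub (sub_ne_zero.mpr fun h => ?_).isUnit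
    exact Finset.ne_of_mem_erase hl (hα (neg_injective (Real.exp_injective h)))
  obtain ⟨a, c, hac⟩ := hcop
  obtain ⟨R, B, hR⟩ := exists_polynomial_approx r (α m) i K
  obtain ⟨B', hB'0, hB'⟩ := exists_bound_of_dvd
    (Dvd.intro_left (c * R) rfl : (X - C (Real.exp (-α m))) ^ (K + 1) ∣
      c * R * (X - C (Real.exp (-α m))) ^ (K + 1))
  refine ⟨w * (a * R), fun l hl => ?_, B + B', fun x hx => ?_⟩
  · exact dvd_mul_of_dvd_left (Finset.dvd_prod_of_mem
      (fun l => (X - C (Real.exp (-α l))) ^ (K + 1)) (Finset.mem_erase.mpr ⟨hl, Finset.mem_univ l⟩)) _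
  · have hG : w * (a * R) = R - c * R * (X - C (Real.exp (-α m))) ^ (K + 1) := by
      linear_combination R * hac
    have hee : Real.exp (-(x * r)) * Real.exp (x * r) = 1 := by
      rw [← Real.exp_add]
      simp
    have h1 := hR x hx
    have h2 := hB' x hx.1
    have h3 : localValue r (α m) (w * (a * R)) x - x ^ i = Real.exp (-(x * r)) *
        ((R.eval (Real.exp (-(x + α m))) - Real.exp (x * r) * x ^ i) -
          (c * R * (X - C (Real.exp (-α m))) ^ (K + 1)).eval (Real.exp (-(x + α m)))) := by
      rw [localValue, hG, eval_sub]
      linear_combination (x ^ i) * hee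
    rw [h3, abs_mul, abs_of_pos (Real.exp_pos _)]
    refine (mul_le_of_le_one_left (abs_nonneg _) (exp_neg_mul_le_one hr hx.1)).trans ?_
    refine (abs_sub _ _).trans ?_
    rw [add_mul]
    exact add_le_add h1 h2

theorem sum_sum_integral_eq {ι : Type*} [Fintype ι] {s : Set ℝ} {ω : ℝ → ℝ} {τ : ι → ℝ → ℝ}
    (hi : ∀ a c, IntegrableOn (fun y => ω y * (τ a y * τ c y)) s) (x : ι → ℝ) :
    ∑ a, ∑ c, x a * x c * ∫ y in s, ω y * (τ a y * τ c y) =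
      ∫ y in s, ω y * (∑ a, x a * τ a y) ^ 2 := by
  have hi' : ∀ a c, IntegrableOn (fun y => x a * x c * (ω y * (τ a y * τ c y))) s := fun a c =>
    Integrable.const_mul (hi a c) _
  simp_rw [← integral_const_mul]
  simp_rw [fun a => (integral_finsetSum Finset.univ fun c _ => hi' a c).symm]
  rw [← integral_finsetSum _ fun a _ => integrable_finsetSum _ fun c _ => hi' a c]
  refine integral_congr_ae (ae_of_all _ fun y => ?_)
  simp only
  rw [sq, Finset.sum_mul_sum]
  simp_rw [Finset.mul_sum]
  refine Finset.sum_congr rfl fun a _ => Finset.sum_congr rfl fun c _ => ?_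
  ring

theorem integrable_sum_sq {ι : Type*} [Fintype ι] {s : Set ℝ} {ω : ℝ → ℝ} {τ : ι → ℝ → ℝ}
    (hi : ∀ a c, IntegrableOn (fun y => ω y * (τ a y * τ c y)) s) (x : ι → ℝ) :
    IntegrableOn (fun y => ω y * (∑ a, x a * τ a y) ^ 2) s := by
  have hi' : ∀ a c, IntegrableOn (fun y => x a * x c * (ω y * (τ a y * τ c y))) s := fun a c =>
    Integrable.const_mul (hi a c) _
  refine Integrable.congr (integrable_finsetSum Finset.univ fun a _ =>
    integrable_finsetSum Finset.univ fun c _ => hi' a c) (ae_of_all _ fun y => ?_)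
  simp only
  rw [sq, Finset.sum_mul_sum]
  simp_rw [Finset.mul_sum]
  refine Finset.sum_congr rfl fun a _ => Finset.sum_congr rfl fun c _ => ?_
  ring

/-- A polynomial equal to `1` to order `2 * S` at `z₀` and smaller elsewhere. -/
noncomputable def cutoffPoly (Z z₀ : ℝ) (S : ℕ) : ℝ[X] :=
  1 - C (Z⁻¹ ^ (2 * S)) * (X - C z₀) ^ (2 * S)

theorem cutoffPoly_eval (Z z₀ : ℝ) (S : ℕ) (z : ℝ) :
    (cutoffPoly Z z₀ S).eval z = 1 - ((Z⁻¹ * (z - z₀)) ^ 2) ^ S := by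
  simp only [cutoffPoly, eval_sub, eval_one, eval_mul, eval_C, eval_pow, eval_X]
  rw [← pow_mul, mul_pow]

theorem cutoffPoly_eval_le (Z z₀ : ℝ) (S : ℕ) (z : ℝ) : (cutoffPoly Z z₀ S).eval z ≤ 1 := by
  rw [cutoffPoly_eval]
  have : 0 ≤ ((Z⁻¹ * (z - z₀)) ^ 2) ^ S := by positivity
  linarith

theorem cutoffPoly_eval_nonneg {Z z₀ : ℝ} (hz₀ : z₀ ∈ Icc 0 Z) (S : ℕ) {z : ℝ}
    (hz : z ∈ Icc 0 Z) : 0 ≤ (cutoffPoly Z z₀ S).eval z := by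
  rw [cutoffPoly_eval, sub_nonneg]
  refine pow_le_one₀ (sq_nonneg _) ?_
  rw [sq_le_one_iff_abs_le_one, abs_mul, abs_inv, abs_of_nonneg (hz.1.trans hz.2)]
  refine inv_mul_le_one_of_le₀ ?_ (hz.1.trans hz.2)
  rw [abs_le]
  constructor <;> linarith [hz.1, hz.2, hz₀.1, hz₀.2]

theorem cutoffPoly_eval_lt {Z z₀ : ℝ} (hZ : 0 < Z) (S : ℕ) {z : ℝ} (hz : z ≠ z₀) :
    (cutoffPoly Z z₀ S).eval z < 1 := by
  rw [cutoffPoly_eval]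
  have : Z⁻¹ * (z - z₀) ≠ 0 := mul_ne_zero (inv_ne_zero hZ.ne') (sub_ne_zero.mpr hz)
  have : 0 < ((Z⁻¹ * (z - z₀)) ^ 2) ^ S := by positivity
  linarith

theorem cutoffPoly_dvd (Z z₀ : ℝ) {n S : ℕ} (h : n ≤ 2 * S) :
    (X - C z₀) ^ n ∣ 1 - cutoffPoly Z z₀ S := by
  rw [cutoffPoly, sub_sub_cancel]
  exact dvd_mul_of_dvd_right (pow_dvd_pow _ h) _

/-- Sharing the factor `exp (-(x * r))` equally makes jets multiplicative; for this reason the jets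
are prescribed with `r / 2`. -/
theorem localValue_half_mul (r α : ℝ) (P Q : ℝ[X]) (x : ℝ) :
    localValue r α (P * Q) x = localValue (r / 2) α P x * localValue (r / 2) α Q x := by
  rw [localValue, localValue, localValue, eval_mul]
  have : Real.exp (-(x * r)) = Real.exp (-(x * (r / 2))) * Real.exp (-(x * (r / 2))) := by
    rw [← Real.exp_add]
    ring_nf
  rw [this]
  ring

theorem exists_bound_mul_sub_mul {f g σ τ : ℝ → ℝ} {n : ℕ} {A B : ℝ}
    (hf : ∀ x ∈ Ioc (0 : ℝ) 1, |f x - σ x| ≤ A * x ^ n)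
    (hg : ∀ x ∈ Ioc (0 : ℝ) 1, |g x - τ x| ≤ B * x ^ n)
    (hσ : ∀ x ∈ Ioc (0 : ℝ) 1, |σ x| ≤ 1) (hτ : ∀ x ∈ Ioc (0 : ℝ) 1, |τ x| ≤ 1) :
    ∀ x ∈ Ioc (0 : ℝ) 1, |f x * g x - σ x * τ x| ≤ (A * (|B| + 1) + B) * x ^ n := by
  intro x hx
  have hxn : 0 ≤ x ^ n := pow_nonneg hx.1.le n
  have hxn1 : x ^ n ≤ 1 := pow_le_one₀ hx.1.le hx.2
  have h1 : |g x| ≤ |B| + 1 := by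
    have h2 : |g x| ≤ |g x - τ x| + |τ x| := by
      simpa using abs_add_le (g x - τ x) (τ x)
    have h3 : B * x ^ n ≤ |B| :=
      (mul_le_mul_of_nonneg_right (le_abs_self B) hxn).trans
        (mul_le_of_le_one_right (abs_nonneg B) hxn1)
    linarith [hg x hx, hτ x hx]
  rw [show f x * g x - σ x * τ x = (f x - σ x) * g x + σ x * (g x - τ x) by ring]
  refine (abs_add_le _ _).trans ?_
  rw [abs_mul, abs_mul]
  have h4 : |f x - σ x| * |g x| ≤ A * x ^ n * (|B| + 1) :=
    mul_le_mul (hf x hx) h1 (abs_nonneg _) ((abs_nonneg _).trans (hf x hx))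
  have h5 : |σ x| * |g x - τ x| ≤ 1 * (B * x ^ n) :=
    mul_le_mul (hσ x hx) (hg x hx) (abs_nonneg _) zero_le_one
  calc _ ≤ A * x ^ n * (|B| + 1) + 1 * (B * x ^ n) := add_le_add h4 h5
    _ = _ := by ring

/-- The Taylor polynomial at the point `α l` of the function attached to the index `a`. -/
noncomputable def jetPoly {M : ℕ} {d : Fin M → ℕ} (a : Σ m, Fin (d m)) (l : Fin M) : ℝ[X] :=
  if a.1 = l then X ^ (a.2 : ℕ) else 0

theorem abs_jetPoly_eval_le {M : ℕ} {d : Fin M → ℕ} (a : Σ m, Fin (d m)) (l : Fin M) :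
    ∀ x ∈ Ioc (0 : ℝ) 1, |(jetPoly a l).eval x| ≤ 1 := by
  intro x hx
  unfold jetPoly
  split_ifs
  · rw [eval_pow, eval_X, abs_of_nonneg (pow_nonneg hx.1.le _)]
    exact pow_le_one₀ hx.1.le hx.2
  · simp

/-- Jets of order at most `n / 2` are exactly those whose products are admissible as regularizing
polynomials, of degree at most `n`. -/
theorem natDegree_jetPoly_mul_le {M : ℕ} {n : Fin M → ℕ} (a c : Σ m, Fin (n m / 2 + 1))
    (l : Fin M) : (jetPoly a l * jetPoly c l).natDegree ≤ n l := by
  have h : ∀ a : Σ m, Fin (n m / 2 + 1), (jetPoly a l).natDegree ≤ n l / 2 := by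
    rintro ⟨m, i⟩
    unfold jetPoly
    split_ifs with hm
    · simp only at hm
      subst hm
      rw [natDegree_X_pow]
      exact Nat.le_of_lt_succ i.2
    · simp
  have h1 := h a
  have h2 := h c
  exact natDegree_mul_le.trans (by omega)

theorem sum_jetPoly_ne_zero {M : ℕ} {d : Fin M → ℕ} {x : (Σ m, Fin (d m)) → ℝ} (hx : x ≠ 0) :
    ∃ l, ∑ a, C (x a) * jetPoly a l ≠ 0 := by
  obtain ⟨⟨l, i⟩, hi⟩ := Function.ne_iff.mp hx
  refine ⟨l, fun h0 => hi ?_⟩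
  have h1 : (∑ a, C (x a) * jetPoly a l).coeff i = x ⟨l, i⟩ := by
    rw [finsetSum_coeff, Finset.sum_eq_single ⟨l, i⟩]
    · simp [jetPoly]
    · rintro ⟨m, j⟩ - hne
      unfold jetPoly
      split_ifs with hm
      · simp only at hm
        subst hm
        rw [coeff_C_mul, coeff_X_pow, if_neg, mul_zero]
        intro hij
        exact hne (by rw [Fin.ext hij])
      · simp
    · simp
  rw [← h1, h0]
  simp

theorem integral_Ioi_one_sq_pos {k : ℝ} {v : ℝ[X]} (hv : v ≠ 0)
    (hi : IntegrableOn (fun y => y ^ (-k - 1) * v.eval y ^ 2) (Ioi 1)) :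
    0 < ∫ y in Ioi (1 : ℝ), y ^ (-k - 1) * v.eval y ^ 2 := by
  rw [setIntegral_pos_iff_support_of_nonneg_ae _ hi]
  · have hfin : {z | v.IsRoot z}.Finite := finite_setOfPred_isRoot hv
    have hsub : Ioi 1 \ {z | v.IsRoot z} ⊆
        (Function.support fun y : ℝ => y ^ (-k - 1) * v.eval y ^ 2) ∩ Ioi 1 := by
      rintro y ⟨hy, hne⟩
      have hy0 : 0 < y := lt_trans zero_lt_one hy
      exact ⟨mul_ne_zero (Real.rpow_pos_of_pos hy0 _).ne' (pow_ne_zero _ hne), hy⟩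
    refine lt_of_lt_of_le ?_ (measure_mono hsub)
    rw [measure_sdiff_null (hfin.measure_zero _)]
    simp
  · refine (ae_restrict_iff' measurableSet_Ioi).mpr (ae_of_all _ fun y hy => ?_)
    have hy0 : 0 < y := lt_trans zero_lt_one hy
    exact mul_nonneg (Real.rpow_pos_of_pos hy0 _).le (sq_nonneg _)

/-- The trial polynomials are `G a * g a.1 ^ N`. For large `N` the convergent part of the form is
close to `∑ l, -c l * ∫ x ^ (-k l - 1) * v l x ^ 2` over `(1, ∞)`, where `v l` is the combined jet
at `α l`; this is positive because `c l < 0`. The other part is nonnegative for every `N`. -/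
theorem exists_posDef_of_neg {M : ℕ} (b r k α : Fin M → ℝ) (hr : ∀ m, 0 < r m)
    (hk : ∀ m, 0 < k m) (hkZ : ∀ m, ∀ j : ℕ, k m ≠ j) (hα : Function.Injective α)
    (hb : ∀ m, b m < 0) :
    ∃ P : (Σ m, Fin (⌊k m⌋₊ / 2 + 1)) → ℝ[X], ∀ x : (Σ m, Fin (⌊k m⌋₊ / 2 + 1)) → ℝ, x ≠ 0 →
      0 < ∑ i, ∑ j, x i * x j * momentFunctional (quasiCarlemanSum b r k α) (P i * P j) := by
  set c : Fin M → ℝ := fun m => b m / tailConst (k m) with hc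
  have hc0 : ∀ m, c m < 0 := fun m => div_neg_of_neg_of_pos (hb m) (tailConst_pos (hk m) (hkZ m))
  set S := ∑ m, (⌊k m⌋₊ + 1) with hS
  have hSm : ∀ m, ⌊k m⌋₊ + 1 ≤ S := le_sum_floor k
  set Z := ∑ m, Real.exp (-α m) with hZ
  have hZm : ∀ m, Real.exp (-α m) ∈ Icc 0 Z := fun m => ⟨(Real.exp_pos _).le, exp_le_sum α m⟩
  have hz : ∀ l, ∀ x : ℝ, 0 < x → Real.exp (-(x + α l)) ∈ Icc 0 Z := fun l x hx =>
    exp_neg_add_mem_Icc (exp_le_sum α l) hx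
  choose G hG0 hG1 using fun a : Σ m, Fin (⌊k m⌋₊ / 2 + 1) =>
    exists_localPoly α hα (half_pos (hr a.1)).le a.1 a.2 S
  set g : Fin M → ℝ[X] := fun m => cutoffPoly Z (Real.exp (-α m)) S with hg
  have hjet : ∀ a l, ∃ B : ℝ, ∀ x ∈ Ioc (0 : ℝ) 1,
      |localValue (r l / 2) (α l) (G a) x - (jetPoly a l).eval x| ≤ B * x ^ (⌊k l⌋₊ + 1) := by
    intro a l
    have hpow : ∀ x ∈ Ioc (0 : ℝ) 1, x ^ (S + 1) ≤ x ^ (⌊k l⌋₊ + 1) := fun x hx =>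
      pow_le_pow_of_le_one hx.1.le hx.2 ((hSm l).trans (Nat.le_succ S))
    by_cases hal : a.1 = l
    · obtain ⟨B, hB⟩ := hG1 a
      refine ⟨|B|, fun x hx => ?_⟩
      have h1 := hB x hx
      subst hal
      rw [jetPoly, if_pos rfl, eval_pow, eval_X]
      refine h1.trans ?_
      exact mul_le_mul (le_abs_self B) (hpow x hx) (pow_nonneg hx.1.le _) (abs_nonneg _)
    · obtain ⟨B, hB0, hB⟩ := exists_bound_of_dvd (hG0 a l (Ne.symm hal))
      refine ⟨B, fun x hx => ?_⟩
      rw [jetPoly, if_neg hal, eval_zero, sub_zero, localValue, abs_mul,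
        abs_of_pos (Real.exp_pos _)]
      refine (mul_le_of_le_one_left (abs_nonneg _)
        (exp_neg_mul_le_one (half_pos (hr l)).le hx.1)).trans ((hB x hx.1).trans ?_)
      exact mul_le_mul_of_nonneg_left (hpow x hx) hB0
  have hlocal : ∀ (a d : Σ m, Fin (⌊k m⌋₊ / 2 + 1)) (l : Fin M), ∃ E : ℕ → ℝ,
      Tendsto E atTop (𝓝 (-∫ x in Ioi (1 : ℝ), x ^ (-k l - 1) *
        (jetPoly a l * jetPoly d l).eval x)) ∧
      ∀ N : ℕ, (∃ B' : ℝ, ∀ x ∈ Ioc (0 : ℝ) 1,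
        |localValue (r l) (α l) (G a * G d * (g a.1 * g d.1) ^ N) x -
          (jetPoly a l * jetPoly d l).eval x| ≤ B' * x ^ (⌊k l⌋₊ + 1)) ∧
      IntegrableOn (fun x => x ^ (-k l - 1) *
        (((g a.1 * g d.1).eval (Real.exp (-(x + α l))) ^ N - 1) *
          (jetPoly a l * jetPoly d l).eval x)) (Ioc 0 1) ∧
      ∫ x in Ioi (0 : ℝ), x ^ (-k l - 1) *
          (localValue (r l) (α l) (G a * G d * (g a.1 * g d.1) ^ N) x -
            (jetPoly a l * jetPoly d l).eval x) =
        E N + ∫ x in Ioc (0 : ℝ) 1, x ^ (-k l - 1) *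
          (((g a.1 * g d.1).eval (Real.exp (-(x + α l))) ^ N - 1) *
            (jetPoly a l * jetPoly d l).eval x) := by
    intro a d l
    obtain ⟨B, hB⟩ := hjet a l
    obtain ⟨B', hB'⟩ := hjet d l
    have hbound := exists_bound_mul_sub_mul hB hB' (abs_jetPoly_eval_le a l)
      (abs_jetPoly_eval_le d l)
    refine local_cutoff (hk l) (hkZ l) (hr l) (α l) (G := G a * G d) (g := g a.1 * g d.1)
      (T := jetPoly a l * jetPoly d l) (natDegree_jetPoly_mul_le a d l)
      (B := B * (|B'| + 1) + B') ?_ ?_ ?_ ?_ ?_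
    · intro x hx
      rw [localValue_half_mul, eval_mul]
      exact hbound x hx
    -- The product of jets at `α l` is nonzero only if both indices sit at `l`; only then must the
    -- cutoff be flat there.
    · by_cases h1 : a.1 = l
      · by_cases h2 : d.1 = l
        · right
          rw [h1, h2]
          have h3 := cutoffPoly_dvd Z (Real.exp (-α l)) ((hSm l).trans (by omega : S ≤ 2 * S))
          have h4 : 1 - g l * g l = (1 - g l) * (1 + g l) := by ring
          rw [h4]
          exact dvd_mul_of_dvd_left h3 _
        · left
          rw [jetPoly, jetPoly, if_neg h2, mul_zero]
      · left
        rw [jetPoly, if_neg h1, zero_mul]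
    · intro x hx
      rw [eval_mul]
      exact mul_nonneg (cutoffPoly_eval_nonneg (hZm _) S (hz l x hx))
        (cutoffPoly_eval_nonneg (hZm _) S (hz l x hx))
    · intro x hx
      rw [eval_mul]
      exact mul_le_one₀ (cutoffPoly_eval_le _ _ _ _)
        (cutoffPoly_eval_nonneg (hZm _) S (hz l x hx)) (cutoffPoly_eval_le _ _ _ _)
    -- The cutoff `g a.1` reaches `1` only at `exp (-α a.1)`, that is, at a single `x`.
    · have hne : ∀ᵐ x : ℝ, x ≠ α a.1 - α l := by
        simp [ae_iff]
      filter_upwards [hne] with x hx hx0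
      have hZ0 : 0 < Z := (Real.exp_pos _).trans_le (hZm l).2
      have hlt := cutoffPoly_eval_lt hZ0 S (z := Real.exp (-(x + α l)))
        (z₀ := Real.exp (-α a.1)) (fun h => hx (by
          have := Real.exp_injective h
          linarith))
      have h1 := cutoffPoly_eval_nonneg (hZm a.1) S (hz l x hx0)
      rw [eval_mul]
      refine ne_of_lt ((mul_le_of_le_one_right h1 ?_).trans_lt hlt)
      exact cutoffPoly_eval_le _ _ _ _
  choose E hElim hE using hlocal
  choose hEbd hEint hEeq using hE
  -- Since the jets vanish unless `a.1 = d.1 = l`, the cutoff weight may be replaced by one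
  -- independent of `a` and `d`, which makes the leftover integral a quadratic form in the jets.
  set ω : Fin M → ℕ → ℝ → ℝ := fun l N x =>
    x ^ (-k l - 1) * ((g l * g l).eval (Real.exp (-(x + α l))) ^ N - 1) with hω
  have hωeq : ∀ (a d : Σ m, Fin (⌊k m⌋₊ / 2 + 1)) l N x, x ^ (-k l - 1) *
      (((g a.1 * g d.1).eval (Real.exp (-(x + α l))) ^ N - 1) *
        (jetPoly a l * jetPoly d l).eval x) =
      ω l N x * ((jetPoly a l).eval x * (jetPoly d l).eval x) := by
    intro a d l N x
    by_cases h1 : a.1 = l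
    · by_cases h2 : d.1 = l
      · simp only [hω]
        rw [h1, h2, eval_mul (p := jetPoly a l)]
        ring
      · have h3 : jetPoly d l = 0 := if_neg h2
        simp [h3]
    · have h3 : jetPoly a l = 0 := if_neg h1
      simp [h3]
  simp_rw [hωeq] at hEint hEeq
  have hmom : ∀ N a d, momentFunctional (quasiCarlemanSum b r k α)
      (G a * g a.1 ^ N * (G d * g d.1 ^ N)) = (∑ l, c l * E a d l N) +
        ∑ l, c l * ∫ x in Ioc (0 : ℝ) 1,
          ω l N x * ((jetPoly a l).eval x * (jetPoly d l).eval x) := by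
    intro N a d
    rw [show G a * g a.1 ^ N * (G d * g d.1 ^ N) = G a * G d * (g a.1 * g d.1) ^ N by ring]
    choose B hB using fun l => hEbd a d l N
    rw [momentFunctional_quasiCarlemanSum b r k α hr hk hkZ _ (fun l => jetPoly a l * jetPoly d l)
      (natDegree_jetPoly_mul_le a d) hB, ← Finset.sum_add_distrib]
    refine Finset.sum_congr rfl fun l _ => ?_
    rw [hEeq, mul_add]
  have hlim : ∀ a d, Tendsto (fun N => ∑ l, c l * E a d l N) atTop
      (𝓝 (∑ l, c l * -∫ x in Ioi (1 : ℝ), x ^ (-k l - 1) *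
        ((jetPoly a l).eval x * (jetPoly d l).eval x))) := by
    intro a d
    refine tendsto_finsetSum _ fun l _ => Tendsto.const_mul _ ?_
    simpa only [eval_mul] using hElim a d l
  have hint1 : ∀ (l : Fin M) (a d : Σ m, Fin (⌊k m⌋₊ / 2 + 1)), IntegrableOn (fun x =>
      x ^ (-k l - 1) * ((jetPoly a l).eval x * (jetPoly d l).eval x)) (Ioi 1) := by
    intro l a d
    have := integrableOn_Ioi_one_eval (hk l) (hkZ l) (natDegree_jetPoly_mul_le a d l)
    simpa only [eval_mul] using this
  have hlimpos : ∀ x : (Σ m, Fin (⌊k m⌋₊ / 2 + 1)) → ℝ, x ≠ 0 → 0 < ∑ a, ∑ d, x a * x d *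
      ∑ l, c l * -∫ y in Ioi (1 : ℝ), y ^ (-k l - 1) *
        ((jetPoly a l).eval y * (jetPoly d l).eval y) := by
    intro x hx
    rw [sum_sum_mul_sum_comm]
    simp_rw [mul_neg (_ * _), Finset.sum_neg_distrib]
    have hq : ∀ l, ∑ a, ∑ d, x a * x d * ∫ y in Ioi (1 : ℝ), y ^ (-k l - 1) *
        ((jetPoly a l).eval y * (jetPoly d l).eval y) =
        ∫ y in Ioi (1 : ℝ), y ^ (-k l - 1) * (∑ a, C (x a) * jetPoly a l).eval y ^ 2 := by
      intro l
      rw [sum_sum_integral_eq (ω := fun y => y ^ (-k l - 1))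
        (τ := fun a y => (jetPoly a l).eval y) (hint1 l) x]
      simp only [eval_finsetSum, eval_mul, eval_C]
    have hqi : ∀ l, IntegrableOn (fun y => y ^ (-k l - 1) *
        (∑ a, C (x a) * jetPoly a l).eval y ^ 2) (Ioi 1) := by
      intro l
      have := integrable_sum_sq (ω := fun y => y ^ (-k l - 1))
        (τ := fun a y => (jetPoly a l).eval y) (hint1 l) x
      simpa only [eval_finsetSum, eval_mul, eval_C] using this
    simp_rw [hq]
    obtain ⟨l, hl⟩ := sum_jetPoly_ne_zero hx
    refine Finset.sum_pos' (fun l _ => ?_) ⟨l, Finset.mem_univ l, ?_⟩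
    · refine mul_nonneg_of_nonpos_of_nonpos (hc0 l).le (neg_nonpos.mpr
        (setIntegral_nonneg measurableSet_Ioi fun y hy => ?_))
      have hy0 : 0 < y := lt_trans zero_lt_one hy
      exact mul_nonneg (Real.rpow_pos_of_pos hy0 _).le (sq_nonneg _)
    · exact mul_pos_of_neg_of_neg (hc0 l) (neg_neg_of_pos (integral_Ioi_one_sq_pos hl (hqi l)))
  obtain ⟨N, hN⟩ := (eventually_posDef_of_tendsto hlim hlimpos).exists
  refine ⟨fun a => G a * g a.1 ^ N, fun x hx => ?_⟩
  simp_rw [hmom, mul_add, Finset.sum_add_distrib]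
  -- The leftover weight is nonpositive because `0 ≤ g l ≤ 1`, and so is each `c l`; its
  -- contribution has the favourable sign whatever its size.
  refine add_pos_of_pos_of_nonneg (hN x hx) ?_
  rw [sum_sum_mul_sum_comm]
  refine Finset.sum_nonneg fun l _ => mul_nonneg_of_nonpos_of_nonpos (hc0 l).le ?_
  rw [sum_sum_integral_eq (ω := ω l N) (τ := fun a y => (jetPoly a l).eval y)
    (fun a d => hEint a d l N) x]
  refine setIntegral_nonpos measurableSet_Ioc fun y hy => ?_
  refine mul_nonpos_of_nonpos_of_nonneg ?_ (sq_nonneg _)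
  refine mul_nonpos_of_nonneg_of_nonpos (Real.rpow_pos_of_pos hy.1 _).le (sub_nonpos.mpr ?_)
  have h0 := cutoffPoly_eval_nonneg (hZm l) S (hz l y hy.1)
  have h1 := cutoffPoly_eval_le Z (Real.exp (-α l)) S (Real.exp (-(y + α l)))
  rw [eval_mul]
  exact pow_le_one₀ (mul_nonneg h0 h0) (mul_le_one₀ h1 h0 h1)

/-! ### Conclusion for both signs. -/

theorem positiveIndex_eq_top {M : ℕ} (b r k α : Fin M → ℝ) (hr : ∀ m, 0 ≤ r m)
    (hk : ∀ m, 0 < k m) (hkZ : ∀ m, ∀ j : ℕ, k m ≠ j) (hα : Function.Injective α)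
    (hb : ∃ m, 0 < b m) : positiveIndex (hankelForm (quasiCarlemanSum b r k α)) = ⊤ := by
  obtain ⟨m₀, hm₀⟩ := hb
  refine ENat.eq_top_iff_forall_ge.mpr fun N => ?_
  -- The coefficients are those of the kernel shifted by `2`, as the functional of
  -- `card_le_positiveIndex` requires; here `r m + 2 > 0` even if `r m = 0`.
  obtain ⟨P, hP⟩ := exists_posDef_of_pos (fun m => b m * Real.exp (-α m * 2)) (fun m => r m + 2) k α
    (fun m => by linarith [hr m]) hk hkZ hα (m₀ := m₀) (mul_pos hm₀ (Real.exp_pos _)) N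
  have h := card_le_positiveIndex (quasiCarlemanSum b r k α) (continuous_quasiCarlemanSum b r k α hk)
    P (by simpa only [quasiCarlemanSum_add_two] using hP)
  simpa using h

theorem positiveIndex_eq {M : ℕ} (b r k α : Fin M → ℝ) (hr : ∀ m, 0 ≤ r m)
    (hk : ∀ m, 0 < k m) (hkZ : ∀ m, ∀ j : ℕ, k m ≠ j) (hα : Function.Injective α)
    (hb : ∀ m, b m < 0) : positiveIndex (hankelForm (quasiCarlemanSum b r k α)) =
      (((∑ m, ⌊k m⌋₊ / 2) + M : ℕ) : ℕ∞) := by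
  refine le_antisymm (positiveIndex_quasiCarlemanSum_le b r k α hr hk hkZ hb) ?_
  obtain ⟨P, hP⟩ := exists_posDef_of_neg (fun m => b m * Real.exp (-α m * 2)) (fun m => r m + 2) k α
    (fun m => by linarith [hr m]) hk hkZ hα fun m => mul_neg_of_neg_of_pos (hb m) (Real.exp_pos _)
  have h := card_le_positiveIndex (quasiCarlemanSum b r k α) (continuous_quasiCarlemanSum b r k α hk)
    P (by simpa only [quasiCarlemanSum_add_two] using hP)
  simpa [Finset.sum_add_distrib] using h

theorem negativeIndex_quasiCarlemanSum {M : ℕ} (b r k α : Fin M → ℝ) :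
    negativeIndex (hankelForm (quasiCarlemanSum b r k α)) =
      positiveIndex (hankelForm (quasiCarlemanSum (fun m => -b m) r k α)) := by
  have h1 : ∀ t, quasiCarlemanSum (fun m => -b m) r k α t = -quasiCarlemanSum b r k α t := by
    intro t
    simp [quasiCarlemanSum]
  unfold negativeIndex
  congr 1
  funext f
  unfold hankelForm halfLinePairing
  simp_rw [h1, Complex.ofReal_neg, neg_mul]
  rw [integral_neg, Complex.neg_re]

theorem theorem6p11 (M : ℕ) (b r k α : Fin M → ℝ)
    (hr : ∀ m, 0 ≤ r m) (hk : ∀ m, 0 < k m) (hkZ : ∀ m, ∀ j : ℕ, k m ≠ j)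
    (hα : Function.Injective α) :
    ((∃ m, 0 < b m) → positiveIndex (hankelForm (quasiCarlemanSum b r k α)) = ⊤) ∧
    ((∃ m, b m < 0) → negativeIndex (hankelForm (quasiCarlemanSum b r k α)) = ⊤) ∧
    ((∀ m, b m < 0) → positiveIndex (hankelForm (quasiCarlemanSum b r k α)) =
      (((∑ m, ⌊k m⌋₊ / 2) + M : ℕ) : ℕ∞)) ∧
    ((∀ m, 0 < b m) → negativeIndex (hankelForm (quasiCarlemanSum b r k α)) =
      (((∑ m, ⌊k m⌋₊ / 2) + M : ℕ) : ℕ∞)) := by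
  refine ⟨positiveIndex_eq_top b r k α hr hk hkZ hα, ?_, positiveIndex_eq b r k α hr hk hkZ hα, ?_⟩
  · rintro ⟨m, hm⟩
    rw [negativeIndex_quasiCarlemanSum]
    exact positiveIndex_eq_top _ r k α hr hk hkZ hα ⟨m, neg_pos.mpr hm⟩
  · intro hb
    rw [negativeIndex_quasiCarlemanSum]
    exact positiveIndex_eq _ r k α hr hk hkZ hα fun m => neg_neg_of_pos (hb m)
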